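/- Let $m\ge 0$, $n\ge 1$ and $\mathbf r=(r_1,\dots,r_n)$ with all $r_i>0$. Let $\mathcal O_t$ be the set of Hermitian endomorphisms $t\,w\otimes w^*$ of $\mathbb C^{m+1}$ with $\|w\|=1$, where $(w\otimes w^*)(v)=(v,w)w$. Let $$\widetilde M_{\mathbf r}=\Big\{(e_1,\dots,e_n)\in\prod_{i}\mathcal O_{r_i}\ \Big|\ \sum_i e_i=\Lambda\,\mathbb I\Big\},\qquad \Lambda=\frac1{m+1}\sum_i r_i,$$ be the space of closed polygons with side lengths $\mathbf r$. The group $U(m+1)$ acts on it by simultaneous conjugation. Let $M_{\mathbf r}=\widetilde M_{\mathbf r}/U(m+1)$ with the quotient topology; closed polygons in a subspace of $\mathbb C^{m+1}$ are defined in the same way, with the dimension of the subspace in place of $m+1$. For $1\le k\le m$ and a partition of $\{1,\dots,n\}$ into nonempty sets $I,J$, the wall $W_{I,J,k}$ is the set of $\mathbf r\in\mathbb R_{>0}^n$ such that $M_{\mathbf r}\neq\emptyset$ and $k\sum_{i\in I}r_i=(m-k+1)\sum_{j\in J}r_j$. A polygon $\mathbf e\in\widetilde M_{\mathbf r}$ is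 decomposable if, for some such $I,J,k$ with $\mathbf r\in W_{I,J,k}$ and some orthogonal decomposition $\mathbb C^{m+1}=V_1\oplus V_2$ with $\dim V_1=m-k+1$ and $\dim V_2=k$, the edges $(e_i)_{i\in I}$ and $(e_j)_{j\in J}$ are the extensions by zero of closed polygons in $V_1$ and $V_2$ with side lengths $(r_i)_{i\in I}$ and $(r_j)_{j\in J}$. Let $\widetilde\Sigma_{\mathbf r}\subset\widetilde M_{\mathbf r}$ be the set of decomposable polygons and $\Sigma_{\mathbf r}$ its image in $M_{\mathbf r}$. Then: (i) $\widetilde M_{\mathbf r}-\widetilde\Sigma_{\mathbf r}$ is a smooth manifold, embedded in the space of $n$-tuples of endomorphisms of $\mathbb C^{m+1}$; if nonempty, it has dimension $2mn-((m+1)^2-1)$. (ii) The quotient of $SU(m+1)$ by its center acts freely on $\widetilde M_{\mathbf r}-\widetilde\Sigma_{\mathbf r}$; that is, the stabilizer in $SU(m+1)$ of each non-decomposable polygon is the center of $SU(m+1)$. The $SU(m+1)$-orbits in $\widetilde M_{\mathbf r}$ are the $U(m+1)$-orbits. The quotient $M_{\mathbf r}-\Sigma_{\mathbf r}$ is a smooth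 (Hausdorff, second countable) manifold, the projection $\widetilde M_{\mathbf r}-\widetilde\Sigma_{\mathbf r}\to M_{\mathbf r}-\Sigma_{\mathbf r}$ is a smooth submersion, and the dimension of $M_{\mathbf r}-\Sigma_{\mathbf r}$, if it is nonempty, is $2m(n-m-2)$. (iii) If $\mathbf r$ lies on no wall, then $\widetilde M_{\mathbf r}$ is an embedded smooth manifold, $M_{\mathbf r}$ is a smooth (Hausdorff, second countable) manifold, the projection $\widetilde M_{\mathbf r}\to M_{\mathbf r}$ is a smooth submersion, and if $M_{\mathbf r}$ is nonempty then $\widetilde M_{\mathbf r}$ has dimension $2mn-((m+1)^2-1)$ and $M_{\mathbf r}$ has real dimension $2m(n-m-2)$. -/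

import Mathlib

open scoped Manifold ContDiff

noncomputable section

namespace HermPolygon

section General

variable (V : Type*) [NormedAddCommGroup V] [InnerProductSpace ℂ V]

/-- The orbit `𝒪_t` of Hermitean endomorphisms `t • (w ⊗ w*)`, `‖w‖ = 1`, where
`(w ⊗ w*) v = (v, w) w` is the orthogonal projection onto the line of `w`. -/
def edgeOrbit (t : ℝ) : Set (V →L[ℂ] V) :=
  {e | ∃ w : V, ‖w‖ = 1 ∧ e = (t : ℂ) • InnerProductSpace.rankOne ℂ w w}

/-- The closed polygons with side lengths `r` in the Hermitean endomorphisms of `V`: tuples of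
edges `e i ∈ 𝒪_{r i}` with `∑ e i = Λ • 1`, where `Λ = (∑ r i) / dim V`. -/
def closedPolygons {ι : Type*} [Fintype ι] (r : ι → ℝ) : Set (ι → (V →L[ℂ] V)) :=
  {e | (∀ i, e i ∈ edgeOrbit V (r i)) ∧
    ∑ i, e i = (((∑ i, r i) / (Module.finrank ℂ V : ℝ) : ℝ) : ℂ) • ContinuousLinearMap.id ℂ V}

variable {V}

/-- Extension by zero of an endomorphism of a subspace `W`: `ι_W ∘ X ∘ π_W`, with `π_W` the
orthogonal projection onto `W`. -/
def extendByZero [FiniteDimensional ℂ V] (W : Submodule ℂ V) (X : W →L[ℂ] W) : V →L[ℂ] V :=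
  W.subtypeL ∘L X ∘L W.orthogonalProjectionOnto

variable {V' : Type*} [NormedAddCommGroup V'] [InnerProductSpace ℂ V']

/-- Transport of an endomorphism along a linear isometry. -/
def transport (L : V ≃ₗᵢ[ℂ] V') (X : V →L[ℂ] V) : V' →L[ℂ] V' :=
  (L.toContinuousLinearEquiv : V →L[ℂ] V') ∘L X ∘L (L.symm.toContinuousLinearEquiv : V' →L[ℂ] V)

theorem transport_apply (L : V ≃ₗᵢ[ℂ] V') (X : V →L[ℂ] V) (v : V') :
    transport L X v = L (X (L.symm v)) := rfl

theorem transport_mem_edgeOrbit (L : V ≃ₗᵢ[ℂ] V') {t : ℝ} {X : V →L[ℂ] V}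
    (hX : X ∈ edgeOrbit V t) : transport L X ∈ edgeOrbit V' t := by
  obtain ⟨w, hw, rfl⟩ := hX
  refine ⟨L w, by simpa using hw, ?_⟩
  ext v
  have h : inner ℂ w (L.symm v) = inner ℂ (L w) v := by
    rw [← L.inner_map_map w (L.symm v), L.apply_symm_apply]
  rw [transport_apply, smul_apply, smul_apply,
    InnerProductSpace.rankOne_apply, InnerProductSpace.rankOne_apply, map_smul, map_smul, h]

theorem transport_mem_closedPolygons {ι : Type*} [Fintype ι] {r : ι → ℝ} (L : V ≃ₗᵢ[ℂ] V')
    {e : ι → (V →L[ℂ] V)} (he : e ∈ closedPolygons V r) :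
    (fun i => transport L (e i)) ∈ closedPolygons V' r := by
  refine ⟨fun i => transport_mem_edgeOrbit L (he.1 i), ?_⟩
  ext v
  have h := congrArg (fun X : V →L[ℂ] V => L (X (L.symm v))) he.2
  simp only [sum_apply, map_sum, L.toLinearEquiv.finrank_eq] at h
  simp only [sum_apply, transport_apply, h]
  rw [smul_apply, smul_apply, map_smul]
  simp

theorem transport_extendByZero [FiniteDimensional ℂ V] [FiniteDimensional ℂ V']
    (L : V ≃ₗᵢ[ℂ] V') (W : Submodule ℂ V) (W' : Submodule ℂ V')
    (hW : W' = W.map (L.toLinearEquiv : V →ₗ[ℂ] V')) :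
    ∃ L' : W ≃ₗᵢ[ℂ] W', ∀ X : W →L[ℂ] W,
      transport L (extendByZero W X) = extendByZero W' (transport L' X) := by
  subst hW
  refine ⟨L.submoduleMap W, fun X => ?_⟩
  ext v
  have h : (W.map (L.toLinearEquiv : V →ₗ[ℂ] V')).orthogonalProjectionOnto v =
      L.submoduleMap W (W.orthogonalProjectionOnto (L.symm v)) := by
    ext
    exact Submodule.starProjection_map_apply L W v
  change L (X (W.orthogonalProjectionOnto (L.symm v)) : V) =
    ((transport (L.submoduleMap W) X
      ((W.map (L.toLinearEquiv : V →ₗ[ℂ] V')).orthogonalProjectionOnto v) :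
        W.map (L.toLinearEquiv : V →ₗ[ℂ] V')) : V')
  rw [h, transport_apply, LinearIsometryEquiv.symm_apply_apply]
  rfl

end General

/-- The Hermitean space `ℂ^{m+1}`. -/
abbrev Cspace (m : ℕ) : Type := EuclideanSpace ℂ (Fin (m + 1))

/-- The unitary group `U(m+1)`. -/
abbrev U (m : ℕ) := Matrix.unitaryGroup (Fin (m + 1)) ℂ

/-- The special unitary group `SU(m+1)`. -/
abbrev SU (m : ℕ) := Matrix.specialUnitaryGroup (Fin (m + 1)) ℂ

/-- A matrix as an operator on `ℂ^{m+1}`. -/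
abbrev toOp {m : ℕ} : Matrix (Fin (m + 1)) (Fin (m + 1)) ℂ ≃⋆ₐ[ℂ] (Cspace m →L[ℂ] Cspace m) :=
  Matrix.toEuclideanCLM (n := Fin (m + 1)) (𝕜 := ℂ)

/-- Conjugation `X ↦ g X g⁻¹` of an operator by a unitary matrix `g`. -/
def conj {m : ℕ} (g : U m) (X : Cspace m →L[ℂ] Cspace m) : Cspace m →L[ℂ] Cspace m :=
  toOp (g : Matrix (Fin (m + 1)) (Fin (m + 1)) ℂ) * X *
    toOp ((g⁻¹ : U m) : Matrix (Fin (m + 1)) (Fin (m + 1)) ℂ)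

theorem exists_conj_eq_transport {m : ℕ} (g : U m) :
    ∃ L : Cspace m ≃ₗᵢ[ℂ] Cspace m, ∀ X, conj g X = transport L X := by
  have hg : toOp (g : Matrix (Fin (m + 1)) (Fin (m + 1)) ℂ) ∈
      unitary (Cspace m →L[ℂ] Cspace m) := Unitary.map_mem toOp g.2
  refine ⟨Unitary.linearIsometryEquiv ⟨_, hg⟩, fun X => ?_⟩
  ext1 v
  have h : toOp ((g⁻¹ : U m) : Matrix (Fin (m + 1)) (Fin (m + 1)) ℂ) =
      star (toOp (g : Matrix (Fin (m + 1)) (Fin (m + 1)) ℂ)) := map_star toOp _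
  rw [conj, h]
  rfl

theorem conj_one {m : ℕ} (X : Cspace m →L[ℂ] Cspace m) : conj 1 X = X := by
  simp [conj]

theorem conj_mul {m : ℕ} (g h : U m) (X : Cspace m →L[ℂ] Cspace m) :
    conj (g * h) X = conj g (conj h X) := by
  simp [conj, mul_assoc]

/-- The space `M̃_r` of closed polygons in the Hermitean endomorphisms of `ℂ^{m+1}`, with the
topology induced from the `n`-tuples of operators. -/
abbrev ClosedPolygon (m : ℕ) {n : ℕ} (r : Fin n → ℝ) : Type := closedPolygons (Cspace m) r

/-- The diagonal action of `U(m+1)` on closed polygons by conjugation. -/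
instance {m n : ℕ} {r : Fin n → ℝ} : MulAction (U m) (ClosedPolygon m r) where
  smul g e := ⟨fun i => conj g (e.1 i), by
    obtain ⟨L, hL⟩ := exists_conj_eq_transport g
    simpa only [hL] using transport_mem_closedPolygons L e.2⟩
  one_smul e := Subtype.ext (funext fun i => conj_one (e.1 i))
  mul_smul g h e := Subtype.ext (funext fun i => conj_mul g h (e.1 i))

theorem smul_polygon_apply {m n : ℕ} {r : Fin n → ℝ} (g : U m) (e : ClosedPolygon m r) (i : Fin n) :
    (g • e).1 i = conj g (e.1 i) := rfl

/-- The restriction of the diagonal action to `SU(m+1)`. -/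
instance {m n : ℕ} {r : Fin n → ℝ} : MulAction (SU m) (ClosedPolygon m r) :=
  MulAction.compHom (ClosedPolygon m r)
    (Submonoid.inclusion (Matrix.specialUnitaryGroup_le_unitaryGroup :
      Matrix.specialUnitaryGroup (Fin (m + 1)) ℂ ≤ Matrix.unitaryGroup (Fin (m + 1)) ℂ))

/-- The moduli space `M_r = M̃_r / U(m+1)`, with the quotient topology. -/
abbrev ModuliSpace (m : ℕ) {n : ℕ} (r : Fin n → ℝ) : Type :=
  Quotient (MulAction.orbitRel (U m) (ClosedPolygon m r))

/-- The quotient map `M̃_r → M_r`. -/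
def proj (m : ℕ) {n : ℕ} (r : Fin n → ℝ) : ClosedPolygon m r → ModuliSpace m r :=
  Quotient.mk _

/-- The cone `C(n, m+1)` of positive side lengths whose moduli space is nonempty. -/
def cone (m n : ℕ) : Set (Fin n → ℝ) :=
  {r | (∀ i, 0 < r i) ∧ Nonempty (ModuliSpace m r)}

/-- The wall `W_{I,J,k}`, with `J` the complement of `I`: the part of the cone on the hyperplane
`k ∑_{i ∈ I} r_i = (m - k + 1) ∑_{j ∈ J} r_j`. -/
def wall (m : ℕ) {n : ℕ} (I : Finset (Fin n)) (k : ℕ) : Set (Fin n → ℝ) :=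
  {r | (k : ℝ) * ∑ i ∈ I, r i = ((m : ℝ) - k + 1) * ∑ j ∈ Iᶜ, r j} ∩ cone m n

/-- `(I, Iᶜ, k)` indexes a wall: `1 ≤ k ≤ m` and `I`, `Iᶜ` are both nonempty. -/
def IsWallIndex (m : ℕ) {n : ℕ} (I : Finset (Fin n)) (k : ℕ) : Prop :=
  1 ≤ k ∧ k ≤ m ∧ I.Nonempty ∧ Iᶜ.Nonempty

/-- `r` lies on a wall. -/
def OnWall (m : ℕ) {n : ℕ} (r : Fin n → ℝ) : Prop :=
  ∃ (I : Finset (Fin n)) (k : ℕ), IsWallIndex m I k ∧ r ∈ wall m I k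

/-- A closed polygon `e` is decomposable if, for some wall `W_{I,J,k}` containing `r` and some
orthogonal decomposition `ℂ^{m+1} = V₁ ⊕ V₁ᗮ` with `dim V₁ = m - k + 1`, `dim V₁ᗮ = k`, its edges
indexed by `I` form a closed polygon `e₁` in `V₁`, and those indexed by `J = Iᶜ` form a closed
polygon `e₂` in `V₁ᗮ`. -/
def IsDecomposable {m n : ℕ} {r : Fin n → ℝ} (e : ClosedPolygon m r) : Prop :=
  ∃ (I : Finset (Fin n)) (k : ℕ) (V₁ : Submodule ℂ (Cspace m)),
    IsWallIndex m I k ∧ r ∈ wall m I k ∧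
    Module.finrank ℂ V₁ + k = m + 1 ∧ Module.finrank ℂ V₁ᗮ = k ∧
    ∃ e₁ ∈ closedPolygons V₁ (fun i : I => r i),
    ∃ e₂ ∈ closedPolygons V₁ᗮ (fun j : (Iᶜ : Finset (Fin n)) => r j),
      (∀ i : I, e.1 i = extendByZero V₁ (e₁ i)) ∧
      (∀ j : (Iᶜ : Finset (Fin n)), e.1 j = extendByZero V₁ᗮ (e₂ j))

theorem IsDecomposable.smul {m n : ℕ} {r : Fin n → ℝ} {e : ClosedPolygon m r}
    (he : IsDecomposable e) (g : U m) : IsDecomposable (g • e) := by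
  obtain ⟨I, k, V₁, hI, hr, h1, h2, e₁, he₁, e₂, he₂, hd₁, hd₂⟩ := he
  obtain ⟨L, hL⟩ := exists_conj_eq_transport g
  have hp : (V₁.map (L.toLinearEquiv : Cspace m →ₗ[ℂ] Cspace m))ᗮ =
      V₁ᗮ.map (L.toLinearEquiv : Cspace m →ₗ[ℂ] Cspace m) :=
    (V₁.map_orthogonal_equiv L).symm
  obtain ⟨L₁, hL₁⟩ := transport_extendByZero L V₁ _ rfl
  obtain ⟨L₂, hL₂⟩ := transport_extendByZero L V₁ᗮ _ hp
  refine ⟨I, k, V₁.map (L.toLinearEquiv : Cspace m →ₗ[ℂ] Cspace m), hI, hr, ?_, ?_,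
    _, transport_mem_closedPolygons L₁ he₁, _, transport_mem_closedPolygons L₂ he₂, ?_, ?_⟩
  · rw [← L₁.toLinearEquiv.finrank_eq, h1]
  · rw [← L₂.toLinearEquiv.finrank_eq, h2]
  · intro i
    rw [smul_polygon_apply, hL, hd₁, hL₁]
  · intro j
    rw [smul_polygon_apply, hL, hd₂, hL₂]

/-- The set `Σ̃_r` of decomposable polygons. -/
def decomposableSet (m : ℕ) {n : ℕ} (r : Fin n → ℝ) : Set (ClosedPolygon m r) :=
  {e | IsDecomposable e}

/-- The image `Σ_r` of `Σ̃_r` in `M_r`. -/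
def singularSet (m : ℕ) {n : ℕ} (r : Fin n → ℝ) : Set (ModuliSpace m r) :=
  proj m r '' decomposableSet m r

theorem proj_notMem_singularSet {m n : ℕ} {r : Fin n → ℝ} {e : ClosedPolygon m r}
    (he : e ∈ (decomposableSet m r)ᶜ) : proj m r e ∈ (singularSet m r)ᶜ := by
  rintro ⟨e', he', h⟩
  obtain ⟨g, hg⟩ := (Quotient.exact h : e' ∈ MulAction.orbit (U m) e)
  refine he ?_
  have h' : e = g⁻¹ • e' := by rw [← hg, inv_smul_smul]
  rw [h']
  exact IsDecomposable.smul he' _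

/-- The quotient map `M̃_r - Σ̃_r → M_r - Σ_r`. -/
def projRegular (m : ℕ) {n : ℕ} (r : Fin n → ℝ) :
    ((decomposableSet m r)ᶜ : Set (ClosedPolygon m r)) →
      ((singularSet m r)ᶜ : Set (ModuliSpace m r)) :=
  fun e => ⟨proj m r e.1, proj_notMem_singularSet e.2⟩

/-- `X` is a smooth manifold of dimension `a`, embedded in the normed space `E` by `i : X → E`,
`Q` is a smooth (Hausdorff, second countable) manifold of dimension `b`, and `p : X → Q` is a
smooth submersion. Here `X` and `Q` carry the topologies they are given with. When `p` is
surjective, this determines both smooth structures. -/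
def IsSmoothQuotient {E : Type} [NormedAddCommGroup E] [NormedSpace ℝ E] {X Q : Type}
    [TopologicalSpace X] [TopologicalSpace Q] (a b : ℕ) (i : X → E) (p : X → Q) : Prop :=
  T2Space Q ∧ SecondCountableTopology Q ∧
  ∃ (_ : ChartedSpace (EuclideanSpace ℝ (Fin a)) X) (_ : ChartedSpace (EuclideanSpace ℝ (Fin b)) Q),
    IsManifold (𝓡 a) ∞ X ∧ Manifold.IsSmoothEmbedding (𝓡 a) 𝓘(ℝ, E) ∞ i ∧
    IsManifold (𝓡 b) ∞ Q ∧ Manifold.IsSubmersion (𝓡 a) (𝓡 b) ∞ p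

end HermPolygon

end

open HermPolygon

/-! A closed polygon is a zero of the moment map, the traceless part of `∑ e i`, on the product of
the orbits `𝒪_{r i}`. Everything rests on `IsIrreducible`: no nonzero traceless Hermitian operator
commutes with all edges. This is equivalent to non-decomposability. A Hermitian operator commuting
with a rank-one edge has the edge vector as an eigenvector, so an eigenspace of a commuting operator
sorts the edges into two subpolygons (`isIrreducible_of_not_isDecomposable`); conversely, the
projection onto `V₁` commutes with every edge of a decomposed polygon
(`not_isDecomposable_of_isIrreducible`).

Irreducibility acts in three ways. Under the trace form, the annihilator of the image of the
differential of the moment map lies in the commutant, so an irreducible polygon is a regular zero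
(`surjective_of_isIrreducible`), and the zero set has codimension `(m+1)^2 - 1` in a product of
dimension `2mn`. The infinitesimal action `A ↦ i[A, e]` of the traceless Hermitian operators is
injective (`injective_of_isIrreducible`), so the orbits have dimension `(m+1)^2 - 1`. By Schur's
lemma (`IsIrreducible.exists_eq_smul_one`) a unitary operator fixing `e` is scalar, whence
`stabilizer_eq_center`.

The smooth structure on the quotient comes from slices. Inside a straightening of the zero set, a
complement of the orbit directions is moved by `exp (i A)`; the inverse function theorem turns this
into a chart of the ambient space, and compactness of `U(m+1)` ensures that a small slice meets each
orbit at most once (`eventually_slice_injective`, `exists_quotientChart`). The slice coordinate is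
then a chart of the quotient (`isSmoothQuotient_of_quotientChart`). Compactness also makes the
quotient Hausdorff. Off the walls no polygon is decomposable, and the same argument covers the whole
space. -/

noncomputable section

namespace HermPolygon

open Set Filter Topology Function

/-! ### Manifold structures on a subset and its quotient from adapted ambient charts. -/

section QuotientCharts

variable {E : Type} [NormedAddCommGroup E] [NormedSpace ℝ E] {X Q : Type}
  {A B C Z : Type} [NormedAddCommGroup A] [NormedSpace ℝ A]
  [NormedAddCommGroup B] [NormedSpace ℝ B] [NormedAddCommGroup C] [NormedSpace ℝ C]
  [NormedAddCommGroup Z] [NormedSpace ℝ Z]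

/-- A smooth straightening of `E` around `i x`, in which `i` becomes the inclusion of
`(B × C) × 0` and `p` becomes the projection to `B`. -/
structure QuotientChart (B C Z : Type) [NormedAddCommGroup B] [NormedSpace ℝ B]
    [NormedAddCommGroup C] [NormedSpace ℝ C] [NormedAddCommGroup Z] [NormedSpace ℝ Z]
    (i : X → E) (p : X → Q) (x : X) where
  toHomeo : OpenPartialHomeomorph E ((B × C) × Z)
  mem_source : i x ∈ toHomeo.source
  smooth : ContDiffOn ℝ ∞ toHomeo toHomeo.source
  smooth_symm : ContDiffOn ℝ ∞ toHomeo.symm toHomeo.target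
  mem_range_iff : ∀ y ∈ toHomeo.source, y ∈ range i ↔ (toHomeo y).2 = 0
  proj_eq_iff : ∀ x₁ x₂, i x₁ ∈ toHomeo.source → i x₂ ∈ toHomeo.source →
    (p x₁ = p x₂ ↔ (toHomeo (i x₁)).1.1 = (toHomeo (i x₂)).1.1)
  -- The `C` and `Z` coordinates may be set to zero inside the target, so every `B` coordinate that
  -- occurs has a preferred representative; it defines the inverse chart of `Q`.
  slice_mem : ∀ t ∈ toHomeo.target, ((t.1.1, 0), 0) ∈ toHomeo.target

namespace QuotientChart

variable {i : X → E} {p : X → Q} {x : X} (c : QuotientChart B C Z i p x)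

/-- The parametrization of `X` by the chart. -/
def param (t : B × C) : X :=
  haveI : Nonempty X := ⟨x⟩
  invFun i (c.toHomeo.symm (t, 0))

theorem apply_param {t : B × C} (ht : (t, 0) ∈ c.toHomeo.target) :
    i (c.param t) = c.toHomeo.symm (t, 0) := by
  have : Nonempty X := ⟨x⟩
  refine invFun_eq ?_
  have := (c.mem_range_iff _ (c.toHomeo.map_target ht)).2 (by rw [c.toHomeo.right_inv ht])
  exact this

theorem param_mem {t : B × C} (ht : (t, 0) ∈ c.toHomeo.target) :
    i (c.param t) ∈ c.toHomeo.source := by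
  rw [c.apply_param ht]
  exact c.toHomeo.map_target ht

theorem toHomeo_param {t : B × C} (ht : (t, 0) ∈ c.toHomeo.target) :
    c.toHomeo (i (c.param t)) = (t, 0) := by
  rw [c.apply_param ht, c.toHomeo.right_inv ht]

theorem toHomeo_apply {y : X} (hy : i y ∈ c.toHomeo.source) :
    ((c.toHomeo (i y)).1, 0) = c.toHomeo (i y) :=
  Prod.ext rfl ((c.mem_range_iff _ hy).1 ⟨y, rfl⟩).symm

theorem toHomeo_apply_mem {y : X} (hy : i y ∈ c.toHomeo.source) :
    ((c.toHomeo (i y)).1, 0) ∈ c.toHomeo.target := by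
  rw [c.toHomeo_apply hy]
  exact c.toHomeo.map_source hy

theorem fst_param_mem {s : B} (hs : ((s, 0), 0) ∈ c.toHomeo.target) :
    (c.toHomeo (i (c.param (s, 0)))).1.1 = s := by
  rw [c.toHomeo_param hs]

theorem proj_param_fst {y : X} (hy : i y ∈ c.toHomeo.source) :
    p (c.param ((c.toHomeo (i y)).1.1, 0)) = p y := by
  have h := c.slice_mem _ (c.toHomeo.map_source hy)
  rw [c.proj_eq_iff _ _ (c.param_mem h) hy, c.toHomeo_param h]

open Classical in
/-- A lift to the chart domain. -/
def lift (q : Q) : X := if h : ∃ y, i y ∈ c.toHomeo.source ∧ p y = q then h.choose else x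

theorem lift_mem {y : X} (hy : i y ∈ c.toHomeo.source) : i (c.lift (p y)) ∈ c.toHomeo.source := by
  have h : ∃ y', i y' ∈ c.toHomeo.source ∧ p y' = p y := ⟨y, hy, rfl⟩
  rw [lift, dif_pos h]
  exact h.choose_spec.1

theorem proj_lift {y : X} (hy : i y ∈ c.toHomeo.source) : p (c.lift (p y)) = p y := by
  have h : ∃ y', i y' ∈ c.toHomeo.source ∧ p y' = p y := ⟨y, hy, rfl⟩
  rw [lift, dif_pos h]
  exact h.choose_spec.2

theorem toHomeo_lift {y : X} (hy : i y ∈ c.toHomeo.source) :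
    (c.toHomeo (i (c.lift (p y)))).1.1 = (c.toHomeo (i y)).1.1 :=
  (c.proj_eq_iff _ _ (c.lift_mem hy) hy).1 (c.proj_lift hy)

variable [TopologicalSpace X]

theorem param_apply (hi : IsEmbedding i) {y : X} (hy : i y ∈ c.toHomeo.source) :
    c.param (c.toHomeo (i y)).1 = y :=
  hi.injective <| by
    rw [c.apply_param (c.toHomeo_apply_mem hy), c.toHomeo_apply hy, c.toHomeo.left_inv hy]

/-- The chart of `X` given by a quotient chart. -/
def domChart (hi : IsEmbedding i) (κ : A ≃L[ℝ] B × C) : OpenPartialHomeomorph X A where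
  toFun y := κ.symm (c.toHomeo (i y)).1
  invFun u := c.param (κ u)
  source := i ⁻¹' c.toHomeo.source
  target := {u | (κ u, 0) ∈ c.toHomeo.target}
  map_source' y hy := by simpa using c.toHomeo_apply_mem hy
  map_target' u hu := c.param_mem hu
  left_inv' y hy := by simpa using c.param_apply hi hy
  right_inv' u hu := by rw [c.toHomeo_param hu]; simp
  open_source := c.toHomeo.open_source.preimage hi.continuous
  open_target := c.toHomeo.open_target.preimage (by fun_prop)
  continuousOn_toFun := by
    refine κ.symm.continuous.comp_continuousOn (continuous_fst.comp_continuousOn ?_)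
    exact c.toHomeo.continuousOn.comp hi.continuous.continuousOn fun y hy => hy
  continuousOn_invFun := by
    rw [hi.isInducing.continuousOn_iff]
    refine ContinuousOn.congr (f := fun u => c.toHomeo.symm (κ u, 0)) ?_
      fun u hu => c.apply_param hu
    exact c.toHomeo.continuousOn_symm.comp (by fun_prop) fun u hu => hu

variable {x' : X} (c' : QuotientChart B C Z i p x')

theorem contDiffOn_domChart_trans (hi : IsEmbedding i) (κ : A ≃L[ℝ] B × C) :
    ContDiffOn ℝ ∞ ((c.domChart hi κ).symm ≫ₕ c'.domChart hi κ)
      ((c.domChart hi κ).symm ≫ₕ c'.domChart hi κ).source := by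
  refine ContDiffOn.congr (f := fun u => κ.symm (c'.toHomeo (c.toHomeo.symm (κ u, 0))).1) ?_ ?_
  · refine κ.symm.contDiff.comp_contDiffOn (contDiff_fst.comp_contDiffOn ?_)
    refine c'.smooth.comp (c.smooth_symm.comp (t := c.toHomeo.target) (by fun_prop) ?_) ?_
    · exact fun u hu => hu.1
    · intro u hu
      have h2 : i (c.param (κ u)) ∈ c'.toHomeo.source := hu.2
      rwa [c.apply_param hu.1] at h2
  · intro u hu
    change κ.symm (c'.toHomeo (i (c.param (κ u)))).1 = _
    rw [c.apply_param hu.1]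

variable [TopologicalSpace Q]

/-- The chart of `Q` given by a quotient chart. -/
def codChart (hi : IsEmbedding i) (hp : Continuous p) (hp' : IsOpenMap p) :
    OpenPartialHomeomorph Q B where
  toFun q := (c.toHomeo (i (c.lift q))).1.1
  invFun s := p (c.param (s, 0))
  source := p '' (i ⁻¹' c.toHomeo.source)
  target := {s | ((s, 0), 0) ∈ c.toHomeo.target}
  map_source' := by
    rintro _ ⟨y, hy, rfl⟩
    change ((_, 0), 0) ∈ c.toHomeo.target
    rw [c.toHomeo_lift hy]
    exact c.slice_mem _ (c.toHomeo.map_source hy)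
  map_target' s hs := ⟨_, c.param_mem hs, rfl⟩
  left_inv' := by
    rintro _ ⟨y, hy, rfl⟩
    simp only [c.toHomeo_lift hy, c.proj_param_fst hy]
  right_inv' s hs := by rw [c.toHomeo_lift (c.param_mem hs), c.fst_param_mem hs]
  open_source := hp' _ (c.toHomeo.open_source.preimage hi.continuous)
  open_target := c.toHomeo.open_target.preimage (by fun_prop)
  continuousOn_toFun := by
    have ho := c.toHomeo.open_source.preimage hi.continuous
    rw [continuousOn_open_iff (hp' _ ho)]
    intro V hV
    have hc : ContinuousOn (fun y => (c.toHomeo (i y)).1.1) (i ⁻¹' c.toHomeo.source) :=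
      (continuous_fst.comp continuous_fst).comp_continuousOn
        (c.toHomeo.continuousOn.comp hi.continuous.continuousOn fun y hy => hy)
    -- The preimage of `V` is the image under the open map `p` of an open subset of `X`.
    convert! hp' _ ((continuousOn_open_iff ho).1 hc V hV) using 1
    ext q
    constructor
    · rintro ⟨⟨y, hy, rfl⟩, hq⟩
      refine ⟨y, ⟨hy, ?_⟩, rfl⟩
      rwa [mem_preimage, c.toHomeo_lift hy] at hq
    · rintro ⟨y, ⟨hy, hyV⟩, rfl⟩
      refine ⟨⟨y, hy, rfl⟩, ?_⟩
      rwa [mem_preimage, c.toHomeo_lift hy]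
  continuousOn_invFun := by
    refine hp.comp_continuousOn ?_
    rw [hi.isInducing.continuousOn_iff]
    refine ContinuousOn.congr (f := fun s => c.toHomeo.symm ((s, 0), 0)) ?_
      fun u hu => c.apply_param hu
    exact c.toHomeo.continuousOn_symm.comp (by fun_prop) fun u hu => hu

/-- Overlapping charts of `Q` may come from charts around different points of one fibre, with
disjoint domains in `X`. The ambient map `g` of `htr` carries one point to the other and respects
fibres, so locally the transition is the `B` coordinate of `c'.toHomeo ∘ g ∘ c.toHomeo.symm`. -/
theorem contDiffOn_codChart_trans (hi : IsEmbedding i) (hp : Continuous p) (hp' : IsOpenMap p)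
    (htr : ∀ y z, p y = p z → ∃ g : E → E, ContDiff ℝ ∞ g ∧ g (i y) = i z ∧
      ∀ y', ∃ z', g (i y') = i z' ∧ p z' = p y') :
    ContDiffOn ℝ ∞ ((c.codChart hi hp hp').symm ≫ₕ c'.codChart hi hp hp')
      ((c.codChart hi hp hp').symm ≫ₕ c'.codChart hi hp hp').source := by
  intro s hs
  have hs1 : ((s, 0), 0) ∈ c.toHomeo.target := hs.1
  obtain ⟨z, hz, hzp⟩ : p (c.param (s, 0)) ∈ p '' (i ⁻¹' c'.toHomeo.source) := hs.2
  obtain ⟨g, hg, hgz, hgr⟩ := htr _ _ hzp.symm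
  have hinner : ContDiffAt ℝ ∞ (fun s : B => g (c.toHomeo.symm ((s, 0), 0))) s := by
    refine hg.contDiffAt.comp s (ContDiffAt.comp s (g := c.toHomeo.symm)
      (f := fun s : B => ((s, (0 : C)), (0 : Z))) ?_ (by fun_prop))
    exact c.smooth_symm.contDiffAt (c.toHomeo.open_target.mem_nhds hs1)
  have hval : g (c.toHomeo.symm ((s, 0), 0)) = i z := by rw [← c.apply_param hs1, hgz]
  have hsm : ContDiffAt ℝ ∞ (fun s : B => (c'.toHomeo (g (c.toHomeo.symm ((s, 0), 0)))).1.1) s := by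
    refine contDiff_fst.contDiffAt.comp s (contDiff_fst.contDiffAt.comp s
      (ContDiffAt.comp s (g := c'.toHomeo) ?_ hinner))
    rw [hval]
    exact c'.smooth.contDiffAt (c'.toHomeo.open_source.mem_nhds hz)
  refine (hsm.congr_of_eventuallyEq ?_).contDiffWithinAt
  have e1 : ∀ᶠ s' in 𝓝 s, ((s', 0), 0) ∈ c.toHomeo.target :=
    (c.codChart hi hp hp').open_target.mem_nhds hs1
  have e2 : ∀ᶠ s' in 𝓝 s, g (c.toHomeo.symm ((s', 0), 0)) ∈ c'.toHomeo.source := by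
    refine hinner.continuousAt.eventually_mem (c'.toHomeo.open_source.mem_nhds ?_)
    rwa [hval]
  filter_upwards [e1, e2] with s' h1 h2
  change (c'.toHomeo (i (c'.lift (p (c.param (s', 0)))))).1.1 = _
  obtain ⟨z', hz', hpz'⟩ := hgr (c.param (s', 0))
  rw [c.apply_param h1] at hz'
  rw [hz'] at h2 ⊢
  rw [← hpz', c'.toHomeo_lift h2]

end QuotientChart

theorem mem_maximalAtlas_self {φ : OpenPartialHomeomorph E E}
    (h : ContDiffOn ℝ ∞ φ φ.source) (h' : ContDiffOn ℝ ∞ φ.symm φ.target) :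
    φ ∈ IsManifold.maximalAtlas 𝓘(ℝ, E) ∞ E := by
  refine StructureGroupoid.mem_maximalAtlas_of_mem_groupoid _ ?_
  rw [contDiffGroupoid, mem_groupoid_of_pregroupoid]
  simpa [contDiffPregroupoid] using ⟨h, h'⟩

variable [TopologicalSpace X] [TopologicalSpace Q]

/-- In these charts `i` and `p` are a linear inclusion and a linear projection, the normal forms of
an immersion with complement `Z` and of a submersion with complement `C`. The equivalences `κ` and
`ℓ` only identify the model spaces. -/
theorem isSmoothQuotient_of_quotientChart {a b : ℕ} {i : X → E} {p : X → Q} (hi : IsEmbedding i)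
    (hp : Continuous p) (hp' : IsOpenMap p) (hps : Surjective p) [T2Space Q]
    [SecondCountableTopology Q]
    (κ : EuclideanSpace ℝ (Fin a) ≃L[ℝ] EuclideanSpace ℝ (Fin b) × C)
    (ℓ : ((EuclideanSpace ℝ (Fin b) × C) × Z) ≃L[ℝ] E)
    (hc : ∀ x, Nonempty (QuotientChart (EuclideanSpace ℝ (Fin b)) C Z i p x))
    (htr : ∀ y z, p y = p z → ∃ g : E → E, ContDiff ℝ ∞ g ∧ g (i y) = i z ∧
      ∀ y', ∃ z', g (i y') = i z' ∧ p z' = p y') :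
    IsSmoothQuotient a b i p := by
  let ch := fun x => (hc x).some
  let χ := fun q => (hps q).choose
  have hχ : ∀ q, p (χ q) = q := fun q => (hps q).choose_spec
  let cX : ChartedSpace (EuclideanSpace ℝ (Fin a)) X :=
    { atlas := range fun x => (ch x).domChart hi κ
      chartAt := fun x => (ch x).domChart hi κ
      mem_chart_source := fun x => (ch x).mem_source
      chart_mem_atlas := fun x => ⟨x, rfl⟩ }
  let cQ : ChartedSpace (EuclideanSpace ℝ (Fin b)) Q :=
    { atlas := range fun x => (ch x).codChart hi hp hp'
      chartAt := fun q => (ch (χ q)).codChart hi hp hp'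
      mem_chart_source := fun q => ⟨χ q, (ch (χ q)).mem_source, hχ q⟩
      chart_mem_atlas := fun q => ⟨χ q, rfl⟩ }
  have mX : IsManifold (𝓡 a) ∞ X := by
    refine isManifold_of_contDiffOn _ _ _ ?_
    rintro _ _ ⟨x, rfl⟩ ⟨y, rfl⟩
    simpa using (ch x).contDiffOn_domChart_trans (ch y) hi κ
  have mQ : IsManifold (𝓡 b) ∞ Q := by
    refine isManifold_of_contDiffOn _ _ _ ?_
    rintro _ _ ⟨x, rfl⟩ ⟨y, rfl⟩
    simpa using (ch x).contDiffOn_codChart_trans (ch y) hi hp hp' htr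
  have dX : ∀ x, (ch x).domChart hi κ ∈ IsManifold.maximalAtlas (𝓡 a) ∞ X := fun x =>
    IsManifold.subset_maximalAtlas ⟨x, rfl⟩
  have dQ : ∀ x, (ch x).codChart hi hp hp' ∈ IsManifold.maximalAtlas (𝓡 b) ∞ Q := fun x =>
    IsManifold.subset_maximalAtlas ⟨x, rfl⟩
  refine ⟨inferInstance, inferInstance, cX, cQ, mX, ⟨⟨Z, inferInstance, inferInstance, fun x => ?_⟩, hi⟩, mQ,
    ⟨C, inferInstance, inferInstance, fun x => ?_⟩⟩
  · refine Manifold.IsImmersionAtOfComplement.mk_of_charts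
      ((κ.prodCongr (ContinuousLinearEquiv.refl ℝ Z)).trans ℓ) ((ch x).domChart hi κ)
      ((ch x).toHomeo.transHomeomorph ℓ.toHomeomorph) (ch x).mem_source (ch x).mem_source (dX x)
      (mem_maximalAtlas_self ?_ ?_) (fun y hy => hy) ?_
    · exact ℓ.contDiff.comp_contDiffOn (ch x).smooth
    · exact (ch x).smooth_symm.comp ℓ.symm.contDiff.contDiffOn fun y hy => hy
    · intro u hu
      have hu' : (κ u, 0) ∈ (ch x).toHomeo.target := by simpa [QuotientChart.domChart] using hu
      change ℓ ((ch x).toHomeo (i ((ch x).param (κ u)))) = ℓ (κ u, 0)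
      rw [(ch x).toHomeo_param hu']
  · refine Manifold.IsSubmersionAtOfComplement.mk_of_charts κ ((ch x).domChart hi κ)
      ((ch x).codChart hi hp hp') (ch x).mem_source ⟨x, (ch x).mem_source, rfl⟩ (dX x) (dQ x)
      (fun y hy => ⟨y, hy, rfl⟩) ?_
    intro u hu
    have hu' : (κ u, 0) ∈ (ch x).toHomeo.target := by simpa [QuotientChart.domChart] using hu
    change ((ch x).toHomeo (i ((ch x).lift (p ((ch x).param (κ u)))))).1.1 = (κ u).1
    rw [(ch x).toHomeo_lift ((ch x).param_mem hu'), (ch x).toHomeo_param hu']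

end QuotientCharts

/-! ### Linear splittings and the inverse function theorem. -/

section LinearAlgebra

variable {E F G : Type*} [NormedAddCommGroup E] [NormedSpace ℝ E] [FiniteDimensional ℝ E]
  [NormedAddCommGroup F] [NormedSpace ℝ F] [FiniteDimensional ℝ F]
  [NormedAddCommGroup G] [NormedSpace ℝ G] [FiniteDimensional ℝ G]

theorem exists_continuousLinearEquiv_of_injective (L : E →L[ℝ] F) (hL : Injective L)
    (h : Module.finrank ℝ E = Module.finrank ℝ F) :
    ∃ L' : E ≃L[ℝ] F, (L' : E →L[ℝ] F) = L :=
  ⟨((L : E →ₗ[ℝ] F).linearEquivOfInjective hL h).toContinuousLinearEquiv, by ext; rfl⟩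

theorem exists_equiv_prod_of_surjective (L : E →L[ℝ] F) (hL : Surjective L)
    (h : Module.finrank ℝ E = Module.finrank ℝ G + Module.finrank ℝ F) :
    ∃ α : E ≃L[ℝ] G × F, ∀ x, (α x).2 = L x := by
  have h1 : Module.finrank ℝ (LinearMap.ker (L : E →ₗ[ℝ] F)) = Module.finrank ℝ G := by
    have h2 := LinearMap.finrank_range_add_finrank_ker (L : E →ₗ[ℝ] F)
    rw [LinearMap.range_eq_top.2 hL, finrank_top] at h2
    omega
  obtain ⟨g, hg⟩ := LinearMap.exists_leftInverse_of_injective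
    (LinearMap.ker (L : E →ₗ[ℝ] F)).subtype (Submodule.ker_subtype _)
  let e : LinearMap.ker (L : E →ₗ[ℝ] F) ≃ₗ[ℝ] G := LinearEquiv.ofFinrankEq _ _ h1
  let T : E →ₗ[ℝ] G × F := ((e : _ →ₗ[ℝ] G) ∘ₗ g).prod L
  have hT : Injective T := by
    refine (injective_iff_map_eq_zero _).2 fun x hx => ?_
    have hx2 : L x = 0 := congrArg Prod.snd hx
    have hx1 : g x = 0 := e.map_eq_zero_iff.1 (congrArg Prod.fst hx)
    have := LinearMap.congr_fun hg ⟨x, hx2⟩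
    simp only [LinearMap.comp_apply, Submodule.subtype_apply, hx1, LinearMap.id_apply] at this
    exact (congrArg Subtype.val this).symm
  exact ⟨(T.linearEquivOfInjective hT (by simp [h])).toContinuousLinearEquiv, fun x => rfl⟩

theorem exists_equiv_prod_of_injective (L : F →L[ℝ] E) (hL : Injective L)
    (h : Module.finrank ℝ E = Module.finrank ℝ G + Module.finrank ℝ F) :
    ∃ α : (G × F) ≃L[ℝ] E, ∀ x, α (0, x) = L x := by
  obtain ⟨S, hS⟩ := Submodule.exists_isCompl (LinearMap.range (L : F →ₗ[ℝ] E))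
  have h1 : Module.finrank ℝ S = Module.finrank ℝ G := by
    have h2 := Submodule.finrank_add_eq_of_isCompl hS
    rw [LinearMap.finrank_range_of_inj hL] at h2
    omega
  let e : G ≃ₗ[ℝ] S := (LinearEquiv.ofFinrankEq _ _ h1).symm
  let T : G × F →ₗ[ℝ] E := (S.subtype ∘ₗ (e : G →ₗ[ℝ] S)).coprod L
  have hT : Injective T := by
    refine (injective_iff_map_eq_zero _).2 fun x hx => ?_
    have hx0 : (e x.1 : E) + L x.2 = 0 := hx
    have hm : L x.2 ∈ S := by
      rw [← neg_eq_of_add_eq_zero_right hx0]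
      exact S.neg_mem (e x.1).2
    have h0 : L x.2 = 0 := Submodule.disjoint_def.1 hS.disjoint _ ⟨x.2, rfl⟩ hm
    rw [h0, add_zero] at hx0
    exact Prod.ext (by simpa using hx0) (hL (by rw [h0]; simp))
  exact ⟨(T.linearEquivOfInjective hT (by simp [h])).toContinuousLinearEquiv, fun x => by
    change (e 0 : E) + L x = L x
    simp⟩

end LinearAlgebra

section InverseFunction

variable {E F : Type*} [NormedAddCommGroup E] [NormedSpace ℝ E] [FiniteDimensional ℝ E]
  [NormedAddCommGroup F] [NormedSpace ℝ F] [FiniteDimensional ℝ F]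

/-- The class `ω` matters: analyticity at a point spreads to a neighbourhood, whereas `ContDiffAt ℝ
∞` at a point need not. The source can thus be shrunk until both the map and its inverse are smooth
throughout. -/
theorem exists_analytic_homeo {f : E → F} {x : E} (hf : ContDiffAt ℝ ω f x) {f' : E →L[ℝ] F}
    (hf' : HasFDerivAt f f' x) (hinj : Injective f')
    (hdim : Module.finrank ℝ E = Module.finrank ℝ F) {N : Set E} (hN : N ∈ 𝓝 x) :
    ∃ φ : OpenPartialHomeomorph E F, (∀ y, φ y = f y) ∧ x ∈ φ.source ∧ φ.source ⊆ N ∧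
      ContDiffOn ℝ ω φ φ.source ∧ ContDiffOn ℝ ω φ.symm φ.target := by
  obtain ⟨L, rfl⟩ := exists_continuousLinearEquiv_of_injective f' hinj hdim
  have : CompleteSpace E := FiniteDimensional.complete ℝ E
  have hω : (ω : ℕ∞ω) ≠ 0 := by simp
  let e := hf.toOpenPartialHomeomorph f hf' hω
  have hxe : x ∈ e.source := hf.mem_toOpenPartialHomeomorph_source hf' hω
  have h2 : ∀ᶠ y in 𝓝 x, ContDiffAt ℝ ω f y := hf.eventually (by simp)
  have h3 : ∀ᶠ y in 𝓝 x, ContDiffAt ℝ ω e.symm (f y) :=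
    hf.continuousAt.eventually ((hf.to_localInverse hf' hω).eventually (by simp))
  obtain ⟨s, hs, hso, hxs⟩ := eventually_nhds_iff.1 ((eventually_mem_set.2 hN).and (h2.and h3))
  refine ⟨e.restrOpen s hso, fun y => rfl, ⟨hxe, hxs⟩, fun y hy => (hs y hy.2).1,
    fun y hy => (hs y hy.2).2.1.contDiffWithinAt, fun y hy => ?_⟩
  have hy' : y ∈ e.target ∧ e.symm y ∈ s := by simpa using hy
  have h := (hs _ hy'.2).2.2
  rw [show f (e.symm y) = y from e.right_inv hy'.1] at h
  exact h.contDiffWithinAt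

end InverseFunction

/-! ### Straightening regular level sets of immersed charts. -/

section Straightening

variable {E W H T Z : Type*} [NormedAddCommGroup E] [NormedSpace ℝ E] [FiniteDimensional ℝ E]
  [NormedAddCommGroup W] [NormedSpace ℝ W] [FiniteDimensional ℝ W]
  [NormedAddCommGroup H] [NormedSpace ℝ H] [FiniteDimensional ℝ H]
  [NormedAddCommGroup T] [NormedSpace ℝ T] [FiniteDimensional ℝ T]
  [NormedAddCommGroup Z] [NormedSpace ℝ Z] [FiniteDimensional ℝ Z]

/-- `φ` straightens the subset `X` of `E` around `x`. -/
structure IsStraightening (φ : OpenPartialHomeomorph E (T × Z)) (X : Set E) (x : E) : Prop where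
  mem_source : x ∈ φ.source
  map_base : φ x = 0
  smooth : ContDiffOn ℝ ω φ φ.source
  smooth_symm : ContDiffOn ℝ ω φ.symm φ.target
  mem_iff : ∀ y ∈ φ.source, y ∈ X ↔ (φ y).2 = 0

/-- A set that is locally the image, under an immersion `P` with smooth left inverse `R`, of a
regular level set of `M` can be straightened. -/
theorem exists_isStraightening {P : W → E} {R : E → W} {M : W → H} {X : Set E} {x : E}
    (hP : ContDiffAt ℝ ω P 0) (hP0 : P 0 = x) (hR : ContDiffAt ℝ ω R x) (hR0 : R x = 0)
    (hRP : ∀ᶠ u in 𝓝 0, R (P u) = u) (hM : ContDiffAt ℝ ω M 0) {M' : W →L[ℝ] H}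
    (hM' : HasFDerivAt M M' 0) (hsurj : Surjective M') (hM0 : M 0 = 0)
    (hMX : ∀ᶠ u in 𝓝 0, M u = 0 → P u ∈ X)
    (hX : ∀ᶠ y in 𝓝 x, y ∈ X → P (R y) = y ∧ M (R y) = 0)
    (hW : Module.finrank ℝ W = Module.finrank ℝ T + Module.finrank ℝ H)
    (hE : Module.finrank ℝ E = Module.finrank ℝ T + Module.finrank ℝ Z) :
    ∃ φ : OpenPartialHomeomorph E (T × Z), IsStraightening φ X x := by
  have hω : (ω : ℕ∞ω) ≠ 0 := by simp
  obtain ⟨α, hα⟩ := exists_equiv_prod_of_surjective (G := T) M' hsurj hW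
  obtain ⟨P', hP'⟩ := hP.differentiableAt hω
  obtain ⟨R', hR'⟩ := hR.differentiableAt hω
  have hRP' : R'.comp P' = ContinuousLinearMap.id ℝ W := by
    have h1 : HasFDerivAt (R ∘ P) (R'.comp P') 0 := HasFDerivAt.comp 0 (by rwa [hP0]) hP'
    exact h1.unique ((hasFDerivAt_id 0).congr_of_eventuallyEq hRP)
  have hR's : Surjective R' := fun w => ⟨P' w, DFunLike.congr_fun hRP' w⟩
  have hWE : Module.finrank ℝ W ≤ Module.finrank ℝ E :=
    LinearMap.finrank_le_finrank_of_injective (f := (P' : W →ₗ[ℝ] E))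
      (LeftInverse.injective (g := R') fun w => DFunLike.congr_fun hRP' w)
  obtain ⟨β, hβ⟩ := exists_equiv_prod_of_surjective
    (G := EuclideanSpace ℝ (Fin (Module.finrank ℝ E - Module.finrank ℝ W))) R' hR's
    (by rw [finrank_euclideanSpace_fin]; omega)
  let K := EuclideanSpace ℝ (Fin (Module.finrank ℝ E - Module.finrank ℝ W))
  let κ : E →L[ℝ] K := (ContinuousLinearMap.fst ℝ K W).comp (β : E →L[ℝ] K × W)
  let π : W →L[ℝ] T := (ContinuousLinearMap.fst ℝ T H).comp (α : W →L[ℝ] T × H)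
  let θ : (H × K) ≃L[ℝ] Z := ContinuousLinearEquiv.ofFinrankEq (by
    rw [Module.finrank_prod, finrank_euclideanSpace_fin]; omega)
  -- The coordinates of `y` are the kernel part of `R y`, the level `M (R y)`, and the deviation of
  -- `y` from the image of `P`, seen along the kernel of `R'`.
  let f : E → T × Z := fun y => (π (R y), θ (M (R y), κ (y - P (R y))))
  have hPR : ContDiffAt ℝ ω (fun y => P (R y)) x := by
    refine ContDiffAt.comp x ?_ hR
    rwa [hR0]
  have hMR : ContDiffAt ℝ ω (fun y => M (R y)) x := by
    refine ContDiffAt.comp x ?_ hR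
    rwa [hR0]
  have hf : ContDiffAt ℝ ω f x :=
    (π.contDiff.contDiffAt.comp x hR).prodMk (θ.contDiff.contDiffAt.comp x
      (hMR.prodMk (κ.contDiff.contDiffAt.comp x (contDiffAt_id.sub hPR))))
  have hPR' : HasFDerivAt (fun y => P (R y)) (P'.comp R') x :=
    HasFDerivAt.comp x (by rwa [hR0]) hR'
  have hMR' : HasFDerivAt (fun y => M (R y)) (M'.comp R') x :=
    HasFDerivAt.comp x (by rwa [hR0]) hR'
  have hf' : HasFDerivAt f ((π.comp R').prod ((θ : H × K →L[ℝ] Z).comp ((M'.comp R').prod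
      (κ.comp (ContinuousLinearMap.id ℝ E - P'.comp R'))))) x :=
    (π.hasFDerivAt.comp x hR').prodMk (θ.hasFDerivAt.comp x
      (hMR'.prodMk (κ.hasFDerivAt.comp x ((hasFDerivAt_id x).sub hPR'))))
  have hinj : Injective ((π.comp R').prod ((θ : H × K →L[ℝ] Z).comp ((M'.comp R').prod
      (κ.comp (ContinuousLinearMap.id ℝ E - P'.comp R'))))) := by
    refine (injective_iff_map_eq_zero _).2 fun v hv => ?_
    have h1 : π (R' v) = 0 := congrArg Prod.fst hv
    have h2 : (M' (R' v), κ (v - P' (R' v))) = (0 : H × K) :=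
      θ.map_eq_zero_iff.1 (congrArg Prod.snd hv)
    have h3 : R' v = 0 := α.map_eq_zero_iff.1 (Prod.ext h1 (by rw [hα]; exact congrArg Prod.fst h2))
    have h4 : κ v = 0 := by simpa [h3] using congrArg Prod.snd h2
    exact β.map_eq_zero_iff.1 (Prod.ext h4 (by rw [hβ, h3]; rfl))
  have hdim : Module.finrank ℝ E = Module.finrank ℝ (T × Z) := by rw [hE, Module.finrank_prod]
  obtain ⟨φ₀, hφ₀, hx₀, -, hs₀, -⟩ := exists_analytic_homeo hf hf' hinj hdim univ_mem
  have e1 : ∀ᶠ y in 𝓝 x, P (R y) ∈ φ₀.source :=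
    hPR.continuousAt.eventually_mem (φ₀.open_source.mem_nhds (by rwa [hR0, hP0]))
  have hRt : Tendsto R (𝓝 x) (𝓝 0) := by
    have := hR.continuousAt.tendsto
    rwa [hR0] at this
  have e2 := hRt.eventually hRP
  have e3 := hRt.eventually hMX
  have e4 : ∀ᶠ y in 𝓝 x, y ∈ φ₀.source := φ₀.open_source.mem_nhds hx₀
  obtain ⟨φ, hφ, hx, hN, hs, hs'⟩ := exists_analytic_homeo hf hf' hinj hdim
    (e1.and (e2.and (e3.and (e4.and hX))))
  refine ⟨φ, hx, ?_, hs, hs', fun y hy => ?_⟩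
  · rw [hφ]
    change (π (R x), θ (M (R x), κ (x - P (R x)))) = 0
    simp [hR0, hM0, hP0]
  · obtain ⟨n1, n2, n3, n4, n5⟩ := hN hy
    rw [hφ]
    change _ ↔ θ (M (R y), κ (y - P (R y))) = 0
    rw [θ.map_eq_zero_iff, Prod.mk_eq_zero]
    constructor
    · intro h
      obtain ⟨h1, h2⟩ := n5 h
      exact ⟨h2, by rw [h1, sub_self, map_zero]⟩
    · rintro ⟨h1, h2⟩
      -- The vanishing of `κ (y - P (R y))` is only part of this equation. But `P (R y)` and `y`
      -- then have the same value under `f`, and both lie in the domain of `φ₀`, where `f` is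
      -- injective; this is why `φ` was restricted a second time.
      have h3 : P (R y) = y := by
        refine φ₀.injOn n1 n4 ?_
        rw [hφ₀, hφ₀]
        change (π (R (P (R y))), θ (M (R (P (R y))), κ (P (R y) - P (R (P (R y)))))) =
          (π (R y), θ (M (R y), κ (y - P (R y))))
        rw [n2, sub_self, map_zero, h2]
      rw [← h3]
      exact n3 h1

end Straightening

/-! ### Slices for compact group actions. -/

/-- A local slice for points moving under a compact group: points of the slice near the base point
in the same orbit agree. -/
theorem eventually_slice_injective {E B C G : Type*} [NormedAddCommGroup E]
    [NormedAddCommGroup B] [NormedAddCommGroup C] [Group G] [TopologicalSpace G] [CompactSpace G]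
    [ContinuousMul G] [MulAction G E] [ContinuousSMul G E] {σ : B → E} {Θ : C × B → E} {ρ : C × E → E} {x : E}
    (hσ : ContinuousAt σ 0) (hσ0 : σ 0 = x) (hΘ : ∀ A s, Θ (A, s) = ρ (A, σ s))
    (hρ0 : ∀ y, ρ (0, y) = y) (hΘi : ∀ᶠ q : (C × B) × (C × B) in 𝓝 0, Θ q.1 = Θ q.2 → q.1 = q.2)
    (hloc : ∀ N ∈ 𝓝 (0 : C), ∀ᶠ g in 𝓝 (1 : G), ∃ A ∈ N, ∀ y : E, g • y = ρ (A, y))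
    (hstab : ∀ g : G, g • x = x → ∀ y : E, g • y = y) :
    ∀ᶠ q : B × B in 𝓝 0, ∀ g : G, g • σ q.1 = σ q.2 → q.1 = q.2 := by
  -- By compactness it is enough to treat group elements near one fixed `g`.
  have key := (isCompact_univ (X := G)).eventually_forall_of_forall_eventually (x₀ := (0 : B × B))
    (P := fun q g => g • σ q.1 = σ q.2 → q.1 = q.2) ?_
  · filter_upwards [key] with q hq g using hq g (mem_univ g)
  intro g _
  have h1 : ContinuousAt (fun z : (B × B) × G => z.2 • σ z.1.1) (0, g) :=
    continuousAt_snd.smul (ContinuousAt.comp (f := fun z : (B × B) × G => z.1.1) hσ (by fun_prop))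
  have h2 : ContinuousAt (fun z : (B × B) × G => σ z.1.2) (0, g) :=
    ContinuousAt.comp (f := fun z : (B × B) × G => z.1.2) hσ (by fun_prop)
  -- If `g` fixes `x`, it acts trivially, so a nearby element acts as `ρ (A, ·)` with `A` small and
  -- injectivity of `Θ` applies. If `g` moves `x`, continuity keeps the moved slice point away from
  -- the slice near `x`.
  by_cases hg : g • x = x
  · obtain ⟨ε, hε, hball⟩ := Metric.eventually_nhds_iff_ball.1 hΘi
    have e1 : ∀ᶠ z : (B × B) × G in 𝓝 (0, g), ∃ A ∈ Metric.ball (0 : C) ε,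
        ∀ y : E, (z.2 * g⁻¹) • y = ρ (A, y) := by
      have hc : Tendsto (fun z : (B × B) × G => z.2 * g⁻¹) (𝓝 (0, g)) (𝓝 1) := by
        have : ContinuousAt (fun z : (B × B) × G => z.2 * g⁻¹) (0, g) := by fun_prop
        simpa [ContinuousAt] using this
      exact hc.eventually (hloc _ (Metric.ball_mem_nhds _ hε))
    have e2 : ∀ᶠ z : (B × B) × G in 𝓝 (0, g), z.1 ∈ Metric.ball (0 : B × B) ε :=
      continuousAt_fst.eventually_mem (Metric.ball_mem_nhds _ hε)
    filter_upwards [e1, e2] with z ⟨A, hA, hAy⟩ hz heq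
    have h3 : Θ (A, z.1.1) = Θ (0, z.1.2) := by
      rw [hΘ, hΘ, hρ0, ← heq, ← hAy, mul_smul]
      congr 1
      rw [inv_smul_eq_iff]
      exact (hstab g hg _).symm
    refine congrArg Prod.snd (hball ((A, z.1.1), (0, z.1.2)) ?_ h3)
    rw [mem_ball_zero_iff] at hA hz ⊢
    have h4 := (norm_fst_le z.1).trans_lt hz
    have h5 := (norm_snd_le z.1).trans_lt hz
    simp only [Prod.norm_def, norm_zero, max_lt_iff] at *
    exact ⟨⟨hA, h4⟩, hε, h5⟩
  · have hne : ∀ᶠ z : (B × B) × G in 𝓝 (0, g), z.2 • σ z.1.1 ≠ σ z.1.2 := by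
      refine (h1.ne_iff_eventually_ne h2).1 ?_
      simpa [hσ0] using hg
    filter_upwards [hne] with z hz h using absurd h hz

/-- An immersion into a straightened set is tangent to the flat directions. -/
theorem IsStraightening.exists_injective_derivative {E C T Z : Type*} [NormedAddCommGroup E]
    [NormedSpace ℝ E] [NormedAddCommGroup C] [NormedSpace ℝ C] [NormedAddCommGroup T]
    [NormedSpace ℝ T] [NormedAddCommGroup Z] [NormedSpace ℝ Z]
    {φ : OpenPartialHomeomorph E (T × Z)} {X : Set E} {x : E} (hφ : IsStraightening φ X x)
    {f : C → E} (hf0 : f 0 = x) (hfX : ∀ A, f A ∈ X) {D : C →L[ℝ] E} (hD : HasFDerivAt f D 0)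
    (hDi : Injective D) {φ' : E →L[ℝ] T × Z} (hφ' : HasFDerivAt φ φ' x) :
    ∃ D' : C →L[ℝ] T, Injective D' ∧ ∀ A, φ' (D A) = (D' A, 0) := by
  subst hf0
  have h0t : (0 : T × Z) ∈ φ.target := by
    rw [← hφ.map_base]
    exact φ.map_source hφ.mem_source
  have hσs : ContDiffAt ℝ ω φ.symm 0 := hφ.smooth_symm.contDiffAt (φ.open_target.mem_nhds h0t)
  obtain ⟨σ', hσ'⟩ := hσs.differentiableAt (by simp)
  have hσφ : ∀ v, σ' (φ' v) = v := by
    have h1 : HasFDerivAt (φ.symm ∘ φ) (σ'.comp φ') (f 0) :=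
      HasFDerivAt.comp _ (by rwa [hφ.map_base]) hφ'
    have h2 : φ.symm ∘ φ =ᶠ[𝓝 (f 0)] id := by
      filter_upwards [φ.open_source.mem_nhds hφ.mem_source] with v hv using φ.left_inv hv
    exact DFunLike.congr_fun (h1.unique ((hasFDerivAt_id _).congr_of_eventuallyEq h2))
  have hD2 : ∀ A, (φ' (D A)).2 = 0 := by
    have h1 : HasFDerivAt (fun A => (φ (f A)).2)
        ((ContinuousLinearMap.snd ℝ T Z).comp (φ'.comp D)) 0 :=
      (ContinuousLinearMap.snd ℝ T Z).hasFDerivAt.comp 0 (HasFDerivAt.comp (g := φ) 0 hφ' hD)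
    have h2 : (fun A => (φ (f A)).2) =ᶠ[𝓝 0] fun _ => 0 := by
      filter_upwards [hD.continuousAt.eventually_mem (φ.open_source.mem_nhds hφ.mem_source)]
        with A hA using (hφ.mem_iff _ hA).1 (hfX A)
    exact DFunLike.congr_fun (h1.unique ((hasFDerivAt_const 0 0).congr_of_eventuallyEq h2))
  have hφD : ∀ A, φ' (D A) = ((φ' (D A)).1, 0) := fun A => Prod.ext rfl (hD2 A)
  refine ⟨(ContinuousLinearMap.fst ℝ T Z).comp (φ'.comp D),
    (injective_iff_map_eq_zero _).2 fun A hA => hDi ?_, hφD⟩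
  rw [← hσφ (D A), hφD, map_zero]
  change (φ' (D A)).1 = 0 at hA
  rw [hA]
  exact map_zero σ'

section Slice

variable {E B C T Z : Type} [NormedAddCommGroup E] [NormedSpace ℝ E] [FiniteDimensional ℝ E]
  [NormedAddCommGroup B] [NormedSpace ℝ B] [FiniteDimensional ℝ B]
  [NormedAddCommGroup C] [NormedSpace ℝ C] [FiniteDimensional ℝ C]
  [NormedAddCommGroup T] [NormedSpace ℝ T] [FiniteDimensional ℝ T]
  [NormedAddCommGroup Z] [NormedSpace ℝ Z] [FiniteDimensional ℝ Z]
  {G : Type*} [Group G] [TopologicalSpace G] [CompactSpace G] [ContinuousMul G] [MulAction G E]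
  [ContinuousSMul G E]

/-- The chart is the inverse of `(s, A, z) ↦ ρ (A, φ.symm (lam s, z))`: choose a point transverse to
the orbit, then move it by the group. The set `range i` is invariant, so it remains `z = 0`, and the
slice coordinate `s` labels orbits. -/
theorem exists_quotientChart {Y Q : Type} {i : Y → E} {p : Y → Q} {y₀ : Y}
    {φ : OpenPartialHomeomorph E (T × Z)} (hφ : IsStraightening φ (range i) (i y₀))
    (hp : ∀ y z, p y = p z ↔ ∃ g : G, g • i y = i z)
    (hG : ∀ (g : G) (y : Y), g • i y ∈ range i)
    (hstab : ∀ g : G, g • i y₀ = i y₀ → ∀ y : E, g • y = y)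
    {ρ : C × E → E} (hρ : ContDiffAt ℝ ω ρ (0, i y₀)) (hρ0 : ∀ y, ρ (0, y) = y)
    (hρG : ∀ A, ∃ g : G, ∀ y, ρ (A, y) = g • y)
    (hloc : ∀ N ∈ 𝓝 (0 : C), ∀ᶠ g in 𝓝 (1 : G), ∃ A ∈ N, ∀ y : E, g • y = ρ (A, y))
    {D : C →L[ℝ] E} (hD : HasFDerivAt (fun A => ρ (A, i y₀)) D 0) (hDi : Injective D)
    (hT : Module.finrank ℝ T = Module.finrank ℝ B + Module.finrank ℝ C)
    (hE : Module.finrank ℝ E = Module.finrank ℝ T + Module.finrank ℝ Z) :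
    Nonempty (QuotientChart B C Z i p y₀) := by
  have hω : (ω : ℕ∞ω) ≠ 0 := by simp
  set x := i y₀ with hx
  have hGiff : ∀ (g : G) (y : E), g • y ∈ range i ↔ y ∈ range i := by
    refine fun g y => ⟨?_, ?_⟩
    · rintro ⟨z, hz⟩
      rw [← inv_smul_smul g y, ← hz]
      exact hG _ z
    · rintro ⟨z, rfl⟩
      exact hG g z
  have hρX : ∀ A y, ρ (A, y) ∈ range i ↔ y ∈ range i := by
    intro A y
    obtain ⟨g, hg⟩ := hρG A
    rw [hg, hGiff]
  have h0t : (0 : T × Z) ∈ φ.target := by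
    rw [← hφ.map_base]
    exact φ.map_source hφ.mem_source
  have hσ0 : φ.symm 0 = x := by rw [← hφ.map_base, φ.left_inv hφ.mem_source]
  have hφs : ContDiffAt ℝ ω φ x := hφ.smooth.contDiffAt (φ.open_source.mem_nhds hφ.mem_source)
  have hσs : ContDiffAt ℝ ω φ.symm 0 := hφ.smooth_symm.contDiffAt (φ.open_target.mem_nhds h0t)
  obtain ⟨φ', hφ'⟩ := hφs.differentiableAt hω
  obtain ⟨σ', hσ'⟩ := hσs.differentiableAt hω
  have hφσ : ∀ v, φ' (σ' v) = v := by
    have h1 : HasFDerivAt (φ ∘ φ.symm) (φ'.comp σ') 0 := HasFDerivAt.comp 0 (by rwa [hσ0]) hσ'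
    have h2 : φ ∘ φ.symm =ᶠ[𝓝 0] id := by
      filter_upwards [φ.open_target.mem_nhds h0t] with v hv using φ.right_inv hv
    exact DFunLike.congr_fun (h1.unique ((hasFDerivAt_id 0).congr_of_eventuallyEq h2))
  obtain ⟨ρ', hρ'⟩ := hρ.differentiableAt hω
  have hρ'D : ∀ A, ρ' (A, 0) = D A := by
    have h1 : HasFDerivAt (fun A => ρ (A, x)) (ρ'.comp (ContinuousLinearMap.inl ℝ C E)) 0 :=
      HasFDerivAt.comp (f := fun A : C => (A, x)) 0 hρ'
        ((hasFDerivAt_id 0).prodMk (hasFDerivAt_const x (0 : C)))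
    exact fun A => DFunLike.congr_fun (h1.unique hD) A
  have hρ'E : ∀ v, ρ' (0, v) = v := by
    have h1 : HasFDerivAt (fun v => ρ (0, v)) (ρ'.comp (ContinuousLinearMap.inr ℝ C E)) x :=
      HasFDerivAt.comp (f := fun v : E => ((0 : C), v)) x hρ'
        ((hasFDerivAt_const (0 : C) x).prodMk (hasFDerivAt_id x))
    simp only [hρ0] at h1
    exact fun v => DFunLike.congr_fun (h1.unique (hasFDerivAt_id x)) v
  have hρ'a : ∀ A v, ρ' (A, v) = D A + v := by
    intro A v
    rw [← hρ'D, ← hρ'E v, ← map_add]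
    simp [hρ'E]
  obtain ⟨D', hD'i, hφD⟩ := hφ.exists_injective_derivative (hρ0 x)
    (fun A => (hρX A x).2 ⟨y₀, rfl⟩) hD hDi hφ'
  -- `D'` gives the orbit directions in `T`; `lam` below parametrizes a complement, the directions
  -- of the slice.
  obtain ⟨τ, hτ⟩ := exists_equiv_prod_of_injective (G := B) D' hD'i hT
  let lam : B →L[ℝ] T := (τ : B × C →L[ℝ] T).comp (ContinuousLinearMap.inl ℝ B C)
  have hτa : ∀ s A, τ (s, A) = lam s + D' A := by
    intro s A
    rw [← hτ A]
    change _ = τ (s, 0) + _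
    rw [← map_add]
    simp
  let j : (B × C) × Z →L[ℝ] T × Z :=
    (lam.comp ((ContinuousLinearMap.fst ℝ B C).comp (ContinuousLinearMap.fst ℝ (B × C) Z))).prod
      (ContinuousLinearMap.snd ℝ (B × C) Z)
  have hj : ∀ t, j t = (lam t.1.1, t.2) := fun t => rfl
  let k : (B × C) × Z →L[ℝ] C :=
    (ContinuousLinearMap.snd ℝ B C).comp (ContinuousLinearMap.fst ℝ (B × C) Z)
  have hk : ∀ t, k t = t.1.2 := fun t => rfl
  let Θ : (B × C) × Z → E := fun t => ρ (k t, φ.symm (j t))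
  have hΘ0 : Θ 0 = x := by
    change ρ (k 0, φ.symm (j 0)) = x
    rw [map_zero, map_zero, hσ0, hρ0]
  have hΘs : ContDiffAt ℝ ω Θ 0 := by
    refine ContDiffAt.comp (g := ρ) (f := fun t => (k t, φ.symm (j t))) 0 ?_
      (k.contDiff.contDiffAt.prodMk (ContDiffAt.comp (g := φ.symm) (f := j) 0 ?_
        j.contDiff.contDiffAt))
    · simpa [hσ0] using hρ
    · simpa using hσs
  have hΘ' : HasFDerivAt Θ (ρ'.comp (k.prod (σ'.comp j))) 0 := by
    refine HasFDerivAt.comp (g := ρ) (f := fun t => (k t, φ.symm (j t))) 0 ?_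
      (k.hasFDerivAt.prodMk (HasFDerivAt.comp (g := φ.symm) (f := j) 0 ?_ j.hasFDerivAt))
    · simpa [hσ0] using hρ'
    · simpa using hσ'
  have hinj : Injective (ρ'.comp (k.prod (σ'.comp j))) := by
    refine (injective_iff_map_eq_zero _).2 fun t ht => ?_
    have h1 : D (k t) + σ' (j t) = 0 := by rw [← hρ'a]; exact ht
    have h2 := congrArg φ' h1
    rw [map_add, hφσ, hφD, hj, hk, map_zero, Prod.mk_add_mk, Prod.mk_eq_zero, zero_add, add_comm,
      ← hτa] at h2
    exact Prod.ext (τ.map_eq_zero_iff.1 h2.1) h2.2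
  have hN : ∀ᶠ t in 𝓝 (0 : (B × C) × Z), j t ∈ φ.target := by
    refine j.continuous.continuousAt.eventually_mem (φ.open_target.mem_nhds ?_)
    rwa [map_zero]
  obtain ⟨ψ, hψ, h0ψ, hψN, hψs, hψs'⟩ := exists_analytic_homeo hΘs hΘ' hinj
    (by rw [Module.finrank_prod, Module.finrank_prod, hE, hT]) hN
  have hinjσ : ∀ᶠ q : B × B in 𝓝 0, ∀ g : G,
      g • φ.symm (lam q.1, 0) = φ.symm (lam q.2, 0) → q.1 = q.2 := by
    refine eventually_slice_injective (σ := fun s => φ.symm (lam s, 0))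
      (Θ := fun t : C × B => Θ ((t.2, t.1), 0)) (ρ := ρ) (x := x) ?_ ?_ (fun A s => rfl) hρ0 ?_
      hloc hstab
    · refine ContinuousAt.comp (g := φ.symm) (f := fun s => (lam s, (0 : Z))) ?_ (by fun_prop)
      rw [map_zero]
      exact hσs.continuousAt
    · rw [map_zero]
      exact hσ0
    · have e1 : ∀ᶠ q : (C × B) × (C × B) in 𝓝 0, ((q.1.2, q.1.1), (0 : Z)) ∈ ψ.source :=
        ContinuousAt.eventually_mem (f := fun q : (C × B) × (C × B) => ((q.1.2, q.1.1), (0 : Z)))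
          (by fun_prop) (ψ.open_source.mem_nhds h0ψ)
      have e2 : ∀ᶠ q : (C × B) × (C × B) in 𝓝 0, ((q.2.2, q.2.1), (0 : Z)) ∈ ψ.source :=
        ContinuousAt.eventually_mem (f := fun q : (C × B) × (C × B) => ((q.2.2, q.2.1), (0 : Z)))
          (by fun_prop) (ψ.open_source.mem_nhds h0ψ)
      filter_upwards [e1, e2] with q h1 h2 h
      have h3 := ψ.injOn h1 h2 (by rw [hψ, hψ]; exact h)
      simp only [Prod.mk.injEq, and_true] at h3
      exact Prod.ext h3.2 h3.1
  obtain ⟨ε₁, hε₁, hb₁⟩ := Metric.eventually_nhds_iff_ball.1 hinjσ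
  obtain ⟨ε₂, hε₂, hb₂⟩ := Metric.mem_nhds_iff.1 (ψ.open_source.mem_nhds h0ψ)
  -- `ε₂` makes the new source exactly a ball for the sup norm, so setting coordinates to zero stays
  -- inside it, which gives `slice_mem`; `ε₁` makes slice points in the same orbit equal.
  let ε := min ε₁ ε₂
  have hε : 0 < ε := lt_min hε₁ hε₂
  let χ := ψ.restrOpen (Metric.ball 0 ε) Metric.isOpen_ball
  have hχs : ∀ t, t ∈ χ.source ↔ t ∈ Metric.ball 0 ε := fun t =>
    ⟨fun h => h.2, fun h => ⟨hb₂ (Metric.ball_subset_ball (min_le_right _ _) h), h⟩⟩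
  have hχt : χ.target ⊆ ψ.target := fun y hy => hy.1
  have hχΘ : ∀ y ∈ χ.target, y = ρ (k (χ.symm y), φ.symm (j (χ.symm y))) := fun y hy => by
    have := χ.right_inv hy
    change ψ (χ.symm y) = y at this
    rw [hψ] at this
    exact this.symm
  have hχj : ∀ y ∈ χ.target, j (χ.symm y) ∈ φ.target := fun y hy => hψN (χ.map_target hy).1
  have hmem : ∀ y ∈ χ.target, y ∈ range i ↔ (χ.symm y).2 = 0 := fun y hy => by
    have h1 := hχΘ y hy
    have h2 := hρX (k (χ.symm y)) (φ.symm (j (χ.symm y)))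
    rw [← h1] at h2
    rw [h2, hφ.mem_iff _ (φ.map_target (hχj y hy)), φ.right_inv (hχj y hy), hj]
  have hχx : Θ 0 ∈ χ.target := by
    have h := χ.map_source ((hχs 0).2 (Metric.mem_ball_self hε))
    change ψ 0 ∈ _ at h
    rwa [hψ] at h
  refine ⟨⟨χ.symm, by rwa [hΘ0] at hχx, ?_, ?_, hmem, fun y z hy hz => ?_, fun t ht => ?_⟩⟩
  · exact (hψs'.mono hχt).of_le (by simp)
  · exact (hψs.mono fun t ht => ht.1).of_le (by simp)
  · have hy0 := (hmem _ hy).1 ⟨y, rfl⟩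
    have hz0 := (hmem _ hz).1 ⟨z, rfl⟩
    have hy1 := hχΘ _ hy
    have hz1 := hχΘ _ hz
    obtain ⟨g, hg⟩ := hρG (k (χ.symm (i y)))
    obtain ⟨h, hh⟩ := hρG (k (χ.symm (i z)))
    rw [hg, hj, hy0] at hy1
    rw [hh, hj, hz0] at hz1
    rw [hp]
    constructor
    · rintro ⟨g', hg'⟩
      rw [hy1, hz1] at hg'
      -- The points `i y` and `i z` are slice points moved by `g` and `h`, so `h⁻¹ * g' * g` carries
      -- one slice point to the other.
      refine hb₁ ((χ.symm (i y)).1.1, (χ.symm (i z)).1.1) ?_ (h⁻¹ * g' * g) ?_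
      · have h1 := (hχs _).1 (χ.map_target hy)
        have h2 := (hχs _).1 (χ.map_target hz)
        rw [mem_ball_zero_iff] at h1 h2 ⊢
        have h3 := (norm_fst_le _).trans_lt ((norm_fst_le _).trans_lt h1)
        have h4 := (norm_fst_le _).trans_lt ((norm_fst_le _).trans_lt h2)
        exact max_lt (h3.trans_le (min_le_left _ _)) (h4.trans_le (min_le_left _ _))
      · rw [mul_smul, mul_smul, hg', inv_smul_smul]
    · intro heq
      refine ⟨h * g⁻¹, ?_⟩
      rw [hy1, hz1, heq, mul_smul, inv_smul_smul]
  · have h1 := (hχs t).1 ht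
    refine (hχs _).2 ?_
    rw [mem_ball_zero_iff] at h1 ⊢
    have h3 := (norm_fst_le _).trans_lt ((norm_fst_le _).trans_lt h1)
    simpa [Prod.norm_def, hε] using h3

end Slice

open Set Filter Topology Function InnerProductSpace

/-! ### Traceless Hermitian operators and irreducible tuples. -/

section Traceless

variable (V : Type*) [NormedAddCommGroup V] [InnerProductSpace ℂ V]

/-- The trace of an operator. -/
def opTrace : (V →L[ℂ] V) →ₗ[ℂ] ℂ := LinearMap.trace ℂ V ∘ₗ ContinuousLinearMap.coeLM ℂ

variable {V}

theorem opTrace_apply (X : V →L[ℂ] V) : opTrace V X = LinearMap.trace ℂ V X := rfl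

/-- The traceless part of an operator. -/
def tracelessPart (X : V →L[ℂ] V) : V →L[ℂ] V :=
  X - (opTrace V X / Module.finrank ℂ V) • (1 : V →L[ℂ] V)

theorem tracelessPart_add (X : V →L[ℂ] V) :
    tracelessPart X + (opTrace V X / Module.finrank ℂ V) • (1 : V →L[ℂ] V) = X :=
  sub_add_cancel _ _

theorem commute_tracelessPart {X Y : V →L[ℂ] V} (h : Commute X Y) : Commute (tracelessPart X) Y :=
  h.sub_left ((Commute.one_left Y).smul_left _)

section Hermitian

variable [CompleteSpace V]

variable (V) in
/-- The traceless Hermitian operators. -/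
def tracelessHermitian : Submodule ℝ (V →L[ℂ] V) where
  carrier := {X | IsSelfAdjoint X ∧ opTrace V X = 0}
  add_mem' hX hY := ⟨hX.1.add hY.1, by rw [map_add, hX.2, hY.2, add_zero]⟩
  zero_mem' := ⟨IsSelfAdjoint.zero _, map_zero _⟩
  smul_mem' c X hX := ⟨(IsSelfAdjoint.all c).smul hX.1, by
    change opTrace V (c • X) = 0
    rw [← Complex.coe_smul, map_smul, hX.2, smul_zero]⟩

theorem mem_tracelessHermitian {X : V →L[ℂ] V} :
    X ∈ tracelessHermitian V ↔ IsSelfAdjoint X ∧ opTrace V X = 0 := Iff.rfl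

theorem add_I_smul_eq_zero {X Y : V →L[ℂ] V} (hX : IsSelfAdjoint X) (hY : IsSelfAdjoint Y)
    (h : X + Complex.I • Y = 0) : X = 0 ∧ Y = 0 := by
  have h1 := congrArg star h
  rw [star_add, hX.star_eq, star_smul, hY.star_eq, star_zero, Complex.star_def, Complex.conj_I,
    neg_smul] at h1
  have h2 : (2 : ℂ) • X = 0 := by
    rw [two_smul, show X + X = X + Complex.I • Y + (X + -(Complex.I • Y)) by abel, h, h1, add_zero]
  have h3 : X = 0 := (smul_eq_zero_iff_right two_ne_zero).1 h2
  refine ⟨h3, ?_⟩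
  rw [h3, zero_add] at h
  exact (smul_eq_zero_iff_right Complex.I_ne_zero).1 h

end Hermitian

variable [FiniteDimensional ℂ V]

theorem opTrace_one : opTrace V 1 = Module.finrank ℂ V := LinearMap.trace_one ℂ V

theorem opTrace_rankOne (x y : V) : opTrace V (rankOne ℂ x y) = inner ℂ y x :=
  trace_rankOne x y

theorem opTrace_mul_rankOne (X : V →L[ℂ] V) (x y : V) :
    opTrace V (X * rankOne ℂ x y) = inner ℂ y (X x) := by
  rw [ContinuousLinearMap.mul_def, comp_rankOne, opTrace_rankOne]

theorem opTrace_tracelessPart [Nontrivial V] (X : V →L[ℂ] V) : opTrace V (tracelessPart X) = 0 := by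
  have h : (Module.finrank ℂ V : ℂ) ≠ 0 := by exact_mod_cast Module.finrank_pos.ne'
  rw [tracelessPart, map_sub, map_smul, opTrace_one, smul_eq_mul, div_mul_cancel₀ _ h, sub_self]

variable [CompleteSpace V]

theorem opTrace_star (X : V →L[ℂ] V) : opTrace V (star X) = star (opTrace V X) := by
  let b := stdOrthonormalBasis ℂ V
  rw [opTrace_apply, opTrace_apply, LinearMap.trace_eq_sum_inner _ b,
    LinearMap.trace_eq_sum_inner _ b, star_sum]
  refine Finset.sum_congr rfl fun j _ => ?_
  change inner ℂ (b j) (ContinuousLinearMap.adjoint X (b j)) =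
    starRingEnd ℂ (inner ℂ (b j) (X (b j)))
  rw [inner_conj_symm, ContinuousLinearMap.adjoint_inner_right]

/-- In an orthonormal basis the trace is the sum of the squared norms of the columns of `X`. -/
theorem eq_zero_of_opTrace_star_mul_self {X : V →L[ℂ] V} (h : (opTrace V (star X * X)).re = 0) :
    X = 0 := by
  let b := stdOrthonormalBasis ℂ V
  have h1 : opTrace V (star X * X) = ∑ j, (‖X (b j)‖ ^ 2 : ℝ) := by
    rw [opTrace_apply, LinearMap.trace_eq_sum_inner _ b, Complex.ofReal_sum]
    refine Finset.sum_congr rfl fun j _ => ?_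
    change inner ℂ (b j) (ContinuousLinearMap.adjoint X (X (b j))) = _
    rw [ContinuousLinearMap.adjoint_inner_right, inner_self_eq_norm_sq_to_K]
    simp
  rw [h1, Complex.ofReal_re, Finset.sum_eq_zero_iff_of_nonneg fun _ _ => by positivity] at h
  have h2 : (X : V →ₗ[ℂ] V) = 0 := b.toBasis.ext fun j => by
    simpa using h j (Finset.mem_univ j)
  exact ContinuousLinearMap.coe_injective h2

theorem tracelessPart_mem [Nontrivial V] {X : V →L[ℂ] V} (hX : IsSelfAdjoint X) :
    tracelessPart X ∈ tracelessHermitian V := by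
  refine ⟨?_, opTrace_tracelessPart X⟩
  have h : star (opTrace V X) = opTrace V X := by rw [← opTrace_star, hX.star_eq]
  rw [tracelessPart, IsSelfAdjoint, star_sub, hX.star_eq, star_smul, star_one, star_div₀, h,
    star_natCast]

/-- Every operator is uniquely `X + iY + z` with `X`, `Y` traceless Hermitian and `z` complex;
comparing real dimensions gives twice the formula. -/
theorem finrank_tracelessHermitian [Nontrivial V] :
    Module.finrank ℝ (tracelessHermitian V) + 1 = Module.finrank ℂ V ^ 2 := by
  let f : tracelessHermitian V × tracelessHermitian V × ℂ →ₗ[ℝ] (V →L[ℂ] V) :=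
    { toFun := fun p => (p.1 : V →L[ℂ] V) + Complex.I • (p.2.1 : V →L[ℂ] V) + p.2.2 • 1
      map_add' := fun p q => by
        simp only [Prod.fst_add, Prod.snd_add, Submodule.coe_add, smul_add, add_smul]
        abel
      map_smul' := fun c p => by
        simp only [Prod.smul_fst, Prod.smul_snd, Submodule.coe_smul, smul_add, RingHom.id_apply,
          smul_comm Complex.I c, smul_assoc] }
  have hf : ∀ p, f p = (p.1 : V →L[ℂ] V) + Complex.I • (p.2.1 : V →L[ℂ] V) + p.2.2 • 1 :=
    fun _ => rfl
  have hd : (Module.finrank ℂ V : ℂ) ≠ 0 := by exact_mod_cast Module.finrank_pos.ne'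
  have hinj : Injective f := by
    refine (injective_iff_map_eq_zero _).2 fun p hp => ?_
    rw [hf] at hp
    have h1 := congrArg (opTrace V) hp
    rw [map_add, map_add, map_smul, map_smul, p.1.2.2, p.2.1.2.2, opTrace_one, map_zero, smul_zero,
      zero_add, zero_add, smul_eq_mul] at h1
    have h2 : p.2.2 = 0 := (mul_eq_zero.1 h1).resolve_right hd
    rw [h2, zero_smul, add_zero] at hp
    obtain ⟨h3, h4⟩ := add_I_smul_eq_zero p.1.2.1 p.2.1.2.1 hp
    exact Prod.ext (Subtype.ext h3) (Prod.ext (Subtype.ext h4) h2)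
  have hsurj : Surjective f := by
    intro T
    refine ⟨(⟨tracelessPart (realPart T : V →L[ℂ] V), tracelessPart_mem (realPart T).2⟩,
      ⟨tracelessPart (imaginaryPart T : V →L[ℂ] V), tracelessPart_mem (imaginaryPart T).2⟩,
      opTrace V T / Module.finrank ℂ V), ?_⟩
    rw [hf]
    conv_rhs => rw [← realPart_add_I_smul_imaginaryPart T]
    have h : opTrace V T = opTrace V (realPart T : V →L[ℂ] V) +
        Complex.I • opTrace V (imaginaryPart T : V →L[ℂ] V) := by
      rw [← map_smul, ← map_add, realPart_add_I_smul_imaginaryPart]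
    simp only [h, tracelessPart, smul_sub, add_div, add_smul, smul_smul, smul_eq_mul, mul_div_assoc]
    abel
  have h1 := (LinearEquiv.ofBijective f ⟨hinj, hsurj⟩).finrank_eq
  have h2 : Module.finrank ℝ (V →L[ℂ] V) = 2 * Module.finrank ℂ V ^ 2 := by
    rw [finrank_real_of_complex, ← (LinearMap.toContinuousLinearMap (𝕜 := ℂ) (E := V)
      (F' := V)).finrank_eq, Module.finrank_linearMap, sq]
  rw [Module.finrank_prod, Module.finrank_prod, h2, Complex.finrank_real_complex] at h1
  omega

/-- The commutant of the edges contains no traceless Hermitian operator except zero. -/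
def IsIrreducible {ι : Type*} (e : ι → (V →L[ℂ] V)) : Prop :=
  ∀ X ∈ tracelessHermitian V, (∀ i, Commute X (e i)) → X = 0

/-- Schur's lemma. The edges are self-adjoint, so the adjoint of `X` commutes with them too; the
traceless parts of the real and imaginary parts of `X` are then zero. -/
theorem IsIrreducible.exists_eq_smul_one [Nontrivial V] {ι : Type*} {e : ι → (V →L[ℂ] V)}
    (h : IsIrreducible e) (he : ∀ i, IsSelfAdjoint (e i)) {X : V →L[ℂ] V}
    (hX : ∀ i, Commute X (e i)) : ∃ z : ℂ, X = z • (1 : V →L[ℂ] V) := by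
  have hX' : ∀ i, Commute (star X) (e i) := fun i => by
    have := (hX i).star_star
    rwa [(he i).star_eq] at this
  have h1 := h _ (tracelessPart_mem (realPart X).2) fun i => commute_tracelessPart (by
    rw [realPart_apply_coe]
    exact ((hX i).add_left (hX' i)).smul_left _)
  have h2 := h _ (tracelessPart_mem (imaginaryPart X).2) fun i => commute_tracelessPart (by
    rw [imaginaryPart_apply_coe]
    exact (((hX i).sub_left (hX' i)).smul_left _).smul_left _)
  rw [tracelessPart, sub_eq_zero] at h1 h2
  refine ⟨opTrace V (realPart X : V →L[ℂ] V) / Module.finrank ℂ V +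
    Complex.I * (opTrace V (imaginaryPart X : V →L[ℂ] V) / Module.finrank ℂ V), ?_⟩
  rw [add_smul, ← smul_smul, ← h1, ← h2, realPart_add_I_smul_imaginaryPart]

/-- It is enough to test operators on the unit sphere, which is compact, and a nonzero commutator
stays nonzero under small changes of both the operator and the tuple. -/
theorem isOpen_isIrreducible {ι : Type*} [Fintype ι] :
    IsOpen {e : ι → (V →L[ℂ] V) | IsIrreducible e} := by
  rw [isOpen_iff_mem_nhds]
  intro e he
  have : FiniteDimensional ℝ (V →L[ℂ] V) := FiniteDimensional.complexToReal _
  have hc : IsCompact (Metric.sphere (0 : tracelessHermitian V) 1) := isCompact_sphere _ _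
  have key := hc.eventually_forall_of_forall_eventually (x₀ := e)
    (P := fun e X => ∃ i, (X : V →L[ℂ] V) * e i - e i * X ≠ 0) ?_
  · filter_upwards [key] with e' he' X hX hcomm
    by_contra hne
    have hX0 : (⟨X, hX⟩ : tracelessHermitian V) ≠ 0 := fun h => hne (congrArg Subtype.val h)
    obtain ⟨i, hi⟩ := he' (‖(⟨X, hX⟩ : tracelessHermitian V)‖⁻¹ • ⟨X, hX⟩) (by
      rw [mem_sphere_zero_iff_norm, norm_smul, norm_inv, norm_norm,
        inv_mul_cancel₀ (norm_ne_zero_iff.2 hX0)])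
    refine hi (sub_eq_zero.2 ?_)
    exact ((hcomm i).smul_left _).eq
  · intro X hX
    have hX0 : (X : V →L[ℂ] V) ≠ 0 := by
      intro h
      have : X = 0 := Subtype.ext h
      simp [this] at hX
    have : ∃ i, ¬ Commute (X : V →L[ℂ] V) (e i) := by
      by_contra! h
      exact hX0 (he X X.2 h)
    obtain ⟨i, hi⟩ := this
    have hcont : Continuous fun z : (ι → (V →L[ℂ] V)) × tracelessHermitian V =>
        (z.2 : V →L[ℂ] V) * z.1 i - z.1 i * z.2 := by fun_prop
    have hne : (X : V →L[ℂ] V) * e i - e i * X ≠ 0 := fun h => hi (sub_eq_zero.1 h)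
    filter_upwards [hcont.continuousAt.eventually_ne hne] with z hz using ⟨i, hz⟩

end Traceless

/-! ### Subpolygons supported on a subspace. -/

section Subpolygons

variable {V : Type*} [NormedAddCommGroup V] [InnerProductSpace ℂ V] [FiniteDimensional ℂ V]
  {ι : Type*} [Fintype ι] {r : ι → ℝ}

/-- Take traces: an edge of length `r i` has trace `r i`. The scalar in a closing condition is
therefore forced, and a subpolygon inherits the scalar of the whole polygon. -/
theorem sum_lengths_eq {e : ι → (V →L[ℂ] V)} (he : ∀ i, e i ∈ edgeOrbit V (r i)) {c : ℝ}
    (h : ∑ i, e i = (c : ℂ) • ContinuousLinearMap.id ℂ V) :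
    ∑ i, r i = c * Module.finrank ℂ V := by
  have h1 := congrArg (opTrace V) h
  have h2 : ∀ i, opTrace V (e i) = r i := by
    intro i
    obtain ⟨w, hw, hi⟩ := he i
    rw [hi, map_smul, opTrace_rankOne, inner_self_eq_norm_sq_to_K, hw]
    simp
  rw [map_sum, Finset.sum_congr rfl fun i _ => h2 i, map_smul] at h1
  change _ = (c : ℂ) • opTrace V 1 at h1
  rw [opTrace_one, smul_eq_mul] at h1
  exact_mod_cast h1

theorem mem_closedPolygons_of_sum_eq [Nontrivial V] {e : ι → (V →L[ℂ] V)}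
    (he : ∀ i, e i ∈ edgeOrbit V (r i)) {c : ℝ}
    (h : ∑ i, e i = (c : ℂ) • ContinuousLinearMap.id ℂ V) : e ∈ closedPolygons V r := by
  refine ⟨he, ?_⟩
  have hd : (Module.finrank ℂ V : ℝ) ≠ 0 := by exact_mod_cast Module.finrank_pos.ne'
  rw [h, sum_lengths_eq he h, mul_div_cancel_right₀ _ hd]

/-- Edges along vectors lying in a subspace or in its orthogonal complement: those in the subspace
form a closed polygon. -/
theorem exists_subpolygon (W : Submodule ℂ V) (hW : W ≠ ⊥) (J : Finset ι) {w : ι → V}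
    (hw : ∀ i, ‖w i‖ = 1) (hin : ∀ i ∈ J, w i ∈ W) (hout : ∀ i ∉ J, w i ∈ Wᗮ) {c : ℝ}
    (hsum : ∑ i, (r i : ℂ) • rankOne ℂ (w i) (w i) = (c : ℂ) • ContinuousLinearMap.id ℂ V) :
    (∃ e₁ ∈ closedPolygons W (fun i : J => r i),
      ∀ i : J, (r i : ℂ) • rankOne ℂ (w i) (w i) = extendByZero W (e₁ i)) ∧
    ∑ i ∈ J, r i = c * Module.finrank ℂ W := by
  have : Nontrivial W := Submodule.nontrivial_iff_ne_bot.2 hW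
  let w' : J → W := fun i => ⟨w i, hin i i.2⟩
  let e₁ : J → (W →L[ℂ] W) := fun i => (r i : ℂ) • rankOne ℂ (w' i) (w' i)
  have h1 : ∀ i : J, e₁ i ∈ edgeOrbit W (r i) := fun i => ⟨w' i, hw i, rfl⟩
  have h2 : ∑ i, e₁ i = (c : ℂ) • ContinuousLinearMap.id ℂ W := by
    ext v
    have h3 := congrArg (fun X : V →L[ℂ] V => X v) hsum
    simp only [sum_apply, smul_apply, rankOne_apply, ContinuousLinearMap.id_apply] at h3
    -- Edges outside `J` kill the vectors of `W`, to which their own vectors are orthogonal.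
    rw [← Finset.sum_subset (Finset.subset_univ J) (fun i _ hi => by
      rw [Submodule.inner_left_of_mem_orthogonal v.2 (hout i hi), zero_smul, smul_zero]),
      ← Finset.sum_coe_sort] at h3
    simpa [e₁, w'] using h3
  refine ⟨⟨e₁, mem_closedPolygons_of_sum_eq h1 h2, fun i => ?_⟩, ?_⟩
  · ext v
    change (r i : ℂ) • (inner ℂ (w i) v • w i) =
      (((r i : ℂ) • (inner ℂ (w' i) (W.orthogonalProjectionOnto v) • w' i) : W) : V)
    rw [Submodule.coe_smul, Submodule.coe_smul, Submodule.coe_inner,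
      ← Submodule.inner_orthogonalProjectionOnto_eq_of_mem_left (w' i) v, Submodule.coe_inner]
  · rw [← Finset.sum_coe_sort]
    exact sum_lengths_eq h1 h2

end Subpolygons

theorem isSelfAdjoint_of_mem_edgeOrbit {V : Type*} [NormedAddCommGroup V]
    [InnerProductSpace ℂ V] [CompleteSpace V] {t : ℝ} {X : V →L[ℂ] V} (hX : X ∈ edgeOrbit V t) :
    IsSelfAdjoint X := by
  obtain ⟨v, -, rfl⟩ := hX
  refine IsSelfAdjoint.smul (by rw [IsSelfAdjoint, Complex.star_def, Complex.conj_ofReal]) ?_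
  rw [ContinuousLinearMap.isSelfAdjoint_iff_isSymmetric]
  exact isSymmetric_rankOne_self _

/-! ### Conjugation by exponentials as coordinates near the identity. -/

section ExpConj

variable {V : Type*} [NormedAddCommGroup V] [InnerProductSpace ℂ V] [CompleteSpace V]
  {ι : Type*}

/-- Conjugation of a tuple of operators by `exp (i A)`, for a traceless Hermitian `A`. -/
def expConj (p : tracelessHermitian V × (ι → (V →L[ℂ] V))) : ι → (V →L[ℂ] V) := fun i =>
  NormedSpace.exp (Complex.I • (p.1 : V →L[ℂ] V)) * p.2 i *
    NormedSpace.exp (-(Complex.I • (p.1 : V →L[ℂ] V)))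

theorem expConj_zero (x : ι → (V →L[ℂ] V)) : expConj (0, x) = x := by
  ext1 i
  simp [expConj]

theorem contDiff_exp_operator : ContDiff ℝ ω (NormedSpace.exp : (V →L[ℂ] V) → (V →L[ℂ] V)) :=
  contDiff_omega_iff_analyticOnNhd.2 fun X _ => NormedSpace.exp_analytic X

theorem contDiff_I_smul_subtype :
    ContDiff ℝ ω fun A : tracelessHermitian V => Complex.I • (A : V →L[ℂ] V) :=
  ((Complex.I • ContinuousLinearMap.id ℂ (V →L[ℂ] V)).restrictScalars ℝ).contDiff.comp
    (tracelessHermitian V).subtypeL.contDiff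

theorem contDiff_expConj [Fintype ι] :
    ContDiff ℝ ω (expConj : tracelessHermitian V × (ι → (V →L[ℂ] V)) → ι → (V →L[ℂ] V)) := by
  refine contDiff_pi.2 fun i => ContDiff.mul (ContDiff.mul ?_ ?_) ?_
  · exact contDiff_exp_operator.comp (contDiff_I_smul_subtype.comp contDiff_fst)
  · exact (ContinuousLinearMap.proj (R := ℝ) (φ := fun _ : ι => V →L[ℂ] V) i).contDiff.comp
      contDiff_snd
  · exact contDiff_exp_operator.comp (contDiff_I_smul_subtype.comp contDiff_fst).neg

theorem exists_hasFDerivAt_expConj [Fintype ι] (x : ι → (V →L[ℂ] V)) :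
    ∃ D : tracelessHermitian V →L[ℝ] (ι → (V →L[ℂ] V)),
      HasFDerivAt (fun A => expConj (A, x)) D 0 ∧
      ∀ A i, D A i = Complex.I • ((A : V →L[ℂ] V) * x i - x i * A) := by
  let J : tracelessHermitian V →L[ℝ] (V →L[ℂ] V) :=
    ((Complex.I • ContinuousLinearMap.id ℂ (V →L[ℂ] V)).restrictScalars ℝ).comp
      (tracelessHermitian V).subtypeL
  have hexp : HasFDerivAt (NormedSpace.exp : (V →L[ℂ] V) → (V →L[ℂ] V))
    (ContinuousLinearMap.id ℝ (V →L[ℂ] V)) 0 := hasFDerivAt_exp_zero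
  have h1 : HasFDerivAt (fun A => NormedSpace.exp (J A)) J 0 := by
    have : HasFDerivAt (NormedSpace.exp : (V →L[ℂ] V) → (V →L[ℂ] V))
      (ContinuousLinearMap.id ℝ (V →L[ℂ] V)) (J 0) := by rwa [map_zero]
    exact this.comp 0 J.hasFDerivAt
  have h2 : HasFDerivAt (fun A => NormedSpace.exp (-(J A))) (-J) 0 := by
    have : HasFDerivAt (NormedSpace.exp : (V →L[ℂ] V) → (V →L[ℂ] V))
      (ContinuousLinearMap.id ℝ (V →L[ℂ] V)) (-(J 0)) := by rwa [map_zero, neg_zero]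
    exact this.comp 0 J.hasFDerivAt.neg
  let D : ι → tracelessHermitian V →L[ℝ] (V →L[ℂ] V) := fun i =>
    ((ContinuousLinearMap.mul ℝ (V →L[ℂ] V)).flip (x i)).comp J -
      ((ContinuousLinearMap.mul ℝ (V →L[ℂ] V)) (x i)).comp J
  have h3 : ∀ i, HasFDerivAt
      (fun A => NormedSpace.exp (J A) * x i * NormedSpace.exp (-(J A))) (D i) 0 := by
    intro i
    refine ((h1.mul_const' (x i)).mul' h2).congr_fderiv ?_
    ext1 A
    simp only [map_zero, neg_zero, NormedSpace.exp_zero, one_mul]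
    change x i * (-(J A)) + (J A * x i) * 1 = J A * x i - x i * J A
    rw [mul_neg, mul_one, neg_add_eq_sub]
  refine ⟨ContinuousLinearMap.pi D, hasFDerivAt_pi.2 h3, fun A i => ?_⟩
  change (Complex.I • (A : V →L[ℂ] V)) * x i - x i * (Complex.I • (A : V →L[ℂ] V)) = _
  rw [smul_mul_assoc, mul_smul_comm, smul_sub]

theorem star_exp_I_smul {X : V →L[ℂ] V} (hX : IsSelfAdjoint X) :
    star (NormedSpace.exp (Complex.I • X)) = NormedSpace.exp (-(Complex.I • X)) := by
  let +nondep : NormedAlgebra ℚ (V →L[ℂ] V) := .restrictScalars ℚ ℂ (V →L[ℂ] V)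
  rw [NormedSpace.star_exp, star_smul, hX.star_eq, Complex.star_def, Complex.conj_I, neg_smul]

theorem expConj_eq_expUnitary (A : tracelessHermitian V) (x : ι → (V →L[ℂ] V)) (i : ι) :
    expConj (A, x) i =
      (selfAdjoint.expUnitary ⟨(A : V →L[ℂ] V), (mem_tracelessHermitian.1 A.2).1⟩ : V →L[ℂ] V) *
        x i * star
          (selfAdjoint.expUnitary ⟨(A : V →L[ℂ] V), (mem_tracelessHermitian.1 A.2).1⟩ :
            V →L[ℂ] V) := by
  rw [expConj, selfAdjoint.expUnitary_coe, star_exp_I_smul (mem_tracelessHermitian.1 A.2).1]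

/-- The exponential of a scalar is central and cancels in a conjugation, so a logarithm may be
replaced by its traceless part. -/
theorem exp_mul_exp_of_sub_eq_smul_one {X Y : V →L[ℂ] V} {z : ℂ} (h : Y = X + z • 1)
    (T : V →L[ℂ] V) : NormedSpace.exp Y * T * NormedSpace.exp (-Y) =
      NormedSpace.exp X * T * NormedSpace.exp (-X) := by
  let +nondep : NormedAlgebra ℚ (V →L[ℂ] V) := .restrictScalars ℚ ℂ (V →L[ℂ] V)
  have hc : ∀ c : ℂ, ∀ S : V →L[ℂ] V, Commute (NormedSpace.exp (c • (1 : V →L[ℂ] V))) S :=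
    fun c S => ((Commute.one_left S).smul_left c).exp_left
  have h0 : NormedSpace.exp (z • (1 : V →L[ℂ] V)) * NormedSpace.exp ((-z) • (1 : V →L[ℂ] V)) = 1 := by
    rw [← NormedSpace.exp_add_of_commute (((Commute.one_left _).smul_left _).smul_right _),
      ← add_smul, add_neg_cancel, zero_smul, NormedSpace.exp_zero]
  rw [h, NormedSpace.exp_add_of_commute ((Commute.one_right X).smul_right z), neg_add, ← neg_smul,
    NormedSpace.exp_add_of_commute ((Commute.one_right (-X)).smul_right (-z)), mul_assoc _ _ T,
    (hc z T).eq, ← (hc (-z) _).eq]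
  simp only [mul_assoc]
  rw [← mul_assoc (NormedSpace.exp (z • (1 : V →L[ℂ] V))), h0, one_mul]

/-- A unitary operator at distance less than `2` from `1` does not have `-1` in its spectrum, so it
has a Hermitian logarithm depending continuously on it; the traceless part induces the same
conjugation. -/
theorem eventually_exists_expConj [FiniteDimensional ℂ V] [Nontrivial V]
    {N : Set (tracelessHermitian V)} (hN : N ∈ 𝓝 0) :
    ∀ᶠ u : unitary (V →L[ℂ] V) in 𝓝 1, ∃ A ∈ N, ∀ x : ι → (V →L[ℂ] V), ∀ i,
      (u : V →L[ℂ] V) * x i * star (u : V →L[ℂ] V) = expConj (A, x) i := by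
  let f : unitary (V →L[ℂ] V) → tracelessHermitian V := fun u =>
    ⟨tracelessPart (Unitary.argSelfAdjoint u : V →L[ℂ] V),
      tracelessPart_mem (Unitary.argSelfAdjoint u).2⟩
  have hball : Metric.ball (1 : unitary (V →L[ℂ] V)) 2 ∈ 𝓝 1 := Metric.ball_mem_nhds _ two_pos
  have harg : Unitary.argSelfAdjoint (1 : unitary (V →L[ℂ] V)) = 0 := by
    have := argSelfAdjoint_expUnitary (A := V →L[ℂ] V) (x := 0) (by simpa using Real.pi_pos)
    rwa [selfAdjoint.expUnitary_zero] at this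
  have htr : Continuous fun X : V →L[ℂ] V => opTrace V X :=
    LinearMap.continuous_of_finiteDimensional _
  have htp : Continuous fun X : V →L[ℂ] V => tracelessPart X := by
    unfold tracelessPart
    fun_prop
  have hf : ContinuousAt f 1 := by
    rw [Topology.IsInducing.subtypeVal.continuousAt_iff]
    exact (htp.comp continuous_subtype_val).continuousAt.comp
      (Unitary.continuousOn_argSelfAdjoint.continuousAt hball)
  have hf1 : f 1 = 0 := by
    ext1
    change tracelessPart (Unitary.argSelfAdjoint (1 : unitary (V →L[ℂ] V)) : V →L[ℂ] V) = 0
    simp [harg, tracelessPart]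
  have h1 : ∀ᶠ u in 𝓝 (1 : unitary (V →L[ℂ] V)), f u ∈ N := hf.eventually_mem (by rwa [hf1])
  filter_upwards [h1, hball] with u hu hub
  refine ⟨f u, hu, fun x i => ?_⟩
  have h2 : selfAdjoint.expUnitary (Unitary.argSelfAdjoint u) = u :=
    expUnitary_argSelfAdjoint (by simpa [Subtype.dist_eq, dist_eq_norm] using hub)
  have h3 : (u : V →L[ℂ] V) =
      NormedSpace.exp (Complex.I • (Unitary.argSelfAdjoint u : V →L[ℂ] V)) := by
    conv_lhs => rw [← h2]
    rw [selfAdjoint.expUnitary_coe]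
  have h4 : star (u : V →L[ℂ] V) =
      NormedSpace.exp (-(Complex.I • (Unitary.argSelfAdjoint u : V →L[ℂ] V))) := by
    rw [h3, star_exp_I_smul (Unitary.argSelfAdjoint u).2]
  rw [h4, h3]
  refine exp_mul_exp_of_sub_eq_smul_one (z := Complex.I *
    (opTrace V (Unitary.argSelfAdjoint u : V →L[ℂ] V) / Module.finrank ℂ V)) ?_ (x i)
  change _ = Complex.I • tracelessPart _ + _
  rw [← smul_smul, ← smul_add, tracelessPart_add]

end ExpConj

/-! ### Non-decomposable polygons are the irreducible ones. -/

section Decomposable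

variable {m n : ℕ} {r : Fin n → ℝ}

theorem exists_edge_vectors (e : ClosedPolygon m r) : ∃ w : Fin n → Cspace m, (∀ i, ‖w i‖ = 1) ∧
    ∀ i, e.1 i = (r i : ℂ) • rankOne ℂ (w i) (w i) := by
  choose w hw using e.2.1
  exact ⟨w, fun i => (hw i).1, fun i => (hw i).2⟩

theorem isSelfAdjoint_edge (e : ClosedPolygon m r) (i : Fin n) : IsSelfAdjoint (e.1 i) :=
  isSelfAdjoint_of_mem_edgeOrbit (e.2.1 i)

/-- A nonzero traceless Hermitian operator in the commutant has a proper eigenspace `V₁`, and each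
edge vector lies in `V₁` or in its orthogonal complement. -/
theorem isIrreducible_of_not_isDecomposable (hn : 0 < n) (hr : ∀ i, 0 < r i)
    {e : ClosedPolygon m r} (h : ¬ IsDecomposable e) : IsIrreducible e.1 := by
  intro X hX hcomm
  by_contra hX0
  refine h ?_
  obtain ⟨w, hw, he⟩ := exists_edge_vectors e
  obtain ⟨μ, hμ⟩ := Module.End.exists_eigenvalue (X : Cspace m →ₗ[ℂ] Cspace m)
  let V₁ := Module.End.eigenspace (X : Cspace m →ₗ[ℂ] Cspace m) μ
  have hV₁ : ∀ v, v ∈ V₁ ↔ X v = μ • v := fun v => Module.End.mem_eigenspace_iff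
  have hbot : V₁ ≠ ⊥ := hμ
  -- Otherwise `X` would be scalar, hence zero, its trace being zero.
  have htop : V₁ ≠ ⊤ := by
    intro htop
    have h1 : X = μ • (1 : Cspace m →L[ℂ] Cspace m) := by
      ext1 v
      exact (hV₁ v).1 (by rw [htop]; trivial)
    have h2 := hX.2
    rw [h1, map_smul, opTrace_one, smul_eq_mul] at h2
    have h3 : (Module.finrank ℂ (Cspace m) : ℂ) ≠ 0 := by exact_mod_cast Module.finrank_pos.ne'
    rw [(mul_eq_zero.1 h2).resolve_right h3] at h1
    exact hX0 (h1.trans (zero_smul ℂ _))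
  have hperp : V₁ᗮ ≠ ⊥ := fun h => htop ((Submodule.orthogonal_eq_bot_iff).1 h)
  have hsym : ∀ v v', inner ℂ (X v) v' = inner ℂ v (X v') :=
    (ContinuousLinearMap.isSelfAdjoint_iff_isSymmetric.1 hX.1)
  -- Evaluating the commutation with the edge at `w i` shows that `w i` is an eigenvector of `X`;
  -- eigenspaces of a Hermitian operator for different eigenvalues are orthogonal.
  have hdich : ∀ i, w i ∉ V₁ → w i ∈ V₁ᗮ := by
    intro i hi
    have h1 : X (w i) = (inner ℂ (w i) (X (w i)) : ℂ) • w i := by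
      have h2 := congrArg (fun T : Cspace m →L[ℂ] Cspace m => T (w i)) (hcomm i).eq
      simp only [he] at h2
      change X ((r i : ℂ) • ((inner ℂ (w i) (w i) : ℂ) • w i)) =
        (r i : ℂ) • ((inner ℂ (w i) (X (w i)) : ℂ) • w i) at h2
      have h3 : (r i : ℂ) ≠ 0 := by exact_mod_cast (hr i).ne'
      rw [map_smul, map_smul, inner_self_eq_norm_sq_to_K, hw] at h2
      simpa using smul_right_injective _ h3 h2
    set ν : ℂ := inner ℂ (w i) (X (w i)) with hν
    have hreal : starRingEnd ℂ ν = ν := by rw [hν, inner_conj_symm, hsym]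
    rw [Submodule.mem_orthogonal']
    intro v hv
    have h2 := hsym (w i) v
    rw [h1, (hV₁ v).1 hv, inner_smul_left, inner_smul_right, hreal] at h2
    have h3 : ν ≠ μ := by
      intro h3
      rw [h3] at h1
      exact hi ((hV₁ _).2 h1)
    have h4 : (ν - μ) * inner ℂ (w i) v = 0 := by rw [sub_mul, h2, sub_self]
    exact (mul_eq_zero.1 h4).resolve_left (sub_ne_zero.2 h3)
  classical
  let I : Finset (Fin n) := Finset.univ.filter fun i => w i ∈ V₁
  have hI : ∀ i, i ∈ I ↔ w i ∈ V₁ := fun i => by simp [I]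
  set c : ℝ := (∑ i, r i) / (Module.finrank ℂ (Cspace m) : ℝ) with hc
  -- Each subpolygon has total length `c` times the dimension of its subspace. With `c` positive
  -- neither index set is empty, and comparing the two lengths gives the wall equation.
  have hcpos : 0 < c := by
    have : Nonempty (Fin n) := ⟨⟨0, hn⟩⟩
    exact div_pos (Finset.sum_pos (fun i _ => hr i) Finset.univ_nonempty)
      (by exact_mod_cast Module.finrank_pos)
  have hsum : ∑ i, (r i : ℂ) • rankOne ℂ (w i) (w i) =
      (c : ℂ) • ContinuousLinearMap.id ℂ (Cspace m) := by
    rw [← e.2.2]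
    exact Finset.sum_congr rfl fun i _ => (he i).symm
  obtain ⟨⟨e₁, he₁, hd₁⟩, hs₁⟩ := exists_subpolygon V₁ hbot I hw (fun i hi => (hI i).1 hi)
    (fun i hi => hdich i fun h => hi ((hI i).2 h)) hsum
  obtain ⟨⟨e₂, he₂, hd₂⟩, hs₂⟩ := exists_subpolygon V₁ᗮ hperp Iᶜ hw
    (fun i hi => hdich i fun h => Finset.mem_compl.1 hi ((hI i).2 h))
    (fun i hi => by
      rw [Submodule.orthogonal_orthogonal]
      simpa [hI] using hi) hsum
  have hdim : Module.finrank ℂ V₁ + Module.finrank ℂ V₁ᗮ = m + 1 := by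
    rw [Submodule.finrank_add_finrank_orthogonal, finrank_euclideanSpace_fin]
  have hp₁ : 0 < Module.finrank ℂ V₁ := by
    have := Submodule.nontrivial_iff_ne_bot.2 hbot
    exact Module.finrank_pos
  have hp₂ : 0 < Module.finrank ℂ V₁ᗮ := by
    have := Submodule.nontrivial_iff_ne_bot.2 hperp
    exact Module.finrank_pos
  have hdim' : (m : ℝ) - Module.finrank ℂ V₁ᗮ + 1 = Module.finrank ℂ V₁ := by
    have : (Module.finrank ℂ V₁ : ℝ) + Module.finrank ℂ V₁ᗮ = m + 1 := by exact_mod_cast hdim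
    linarith
  refine ⟨I, Module.finrank ℂ V₁ᗮ, V₁, ⟨hp₂, by omega, ?_, ?_⟩, ⟨?_, hr, ⟨proj m r e⟩⟩, hdim, rfl,
    e₁, he₁, e₂, he₂, fun i => (he i).trans (hd₁ i), fun j => (he j).trans (hd₂ j)⟩
  · refine Finset.nonempty_iff_ne_empty.2 fun h0 => ?_
    rw [h0, Finset.sum_empty] at hs₁
    have : (0 : ℝ) < Module.finrank ℂ V₁ := by exact_mod_cast hp₁
    exact (mul_pos hcpos this).ne hs₁
  · refine Finset.nonempty_iff_ne_empty.2 fun h0 => ?_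
    rw [h0, Finset.sum_empty] at hs₂
    have : (0 : ℝ) < Module.finrank ℂ V₁ᗮ := by exact_mod_cast hp₂
    exact (mul_pos hcpos this).ne hs₂
  · change (_ : ℝ) = _
    rw [hs₁, hs₂, hdim']
    ring

/-- The projection onto `V₁` commutes with all edges. It is not scalar, being the identity on `V₁`
and zero on `V₁ᗮ`, both of which are nonzero. -/
theorem not_isDecomposable_of_isIrreducible {e : ClosedPolygon m r} (h : IsIrreducible e.1) :
    ¬ IsDecomposable e := by
  rintro ⟨I, k, V₁, ⟨hk, hkm, -, -⟩, -, hd, hd', e₁, -, e₂, -, h₁, h₂⟩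
  have hP : ∀ i, Commute V₁.starProjection (e.1 i) := by
    intro i
    by_cases hi : i ∈ I
    · have h3 := h₁ ⟨i, hi⟩
      simp only at h3
      rw [h3]
      ext1 v
      change V₁.starProjection (e₁ ⟨i, hi⟩ (V₁.orthogonalProjectionOnto v) : Cspace m) =
        (e₁ ⟨i, hi⟩ (V₁.orthogonalProjectionOnto (V₁.orthogonalProjectionOnto v : Cspace m)) :
          Cspace m)
      rw [Submodule.starProjection_eq_self_iff.2 (Submodule.coe_mem _),
        Submodule.orthogonalProjectionOnto_mem_subspace_eq_self]
    · have h3 := h₂ ⟨i, Finset.mem_compl.2 hi⟩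
      simp only at h3
      rw [h3]
      ext1 v
      set j : (Iᶜ : Finset (Fin n)) := ⟨i, Finset.mem_compl.2 hi⟩
      change V₁.starProjection (e₂ j (V₁ᗮ.orthogonalProjectionOnto v) : Cspace m) =
        (e₂ j (V₁ᗮ.orthogonalProjectionOnto (V₁.orthogonalProjectionOnto v : Cspace m)) :
          Cspace m)
      rw [(Submodule.starProjection_apply_eq_zero_iff V₁).2 (Submodule.coe_mem _),
        Submodule.orthogonalProjectionOnto_eq_zero_iff.2
          (V₁.le_orthogonal_orthogonal (Submodule.coe_mem _)), map_zero, Submodule.coe_zero]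
  have h0 := h _ (tracelessPart_mem (isSelfAdjoint_starProjection V₁))
    fun i => commute_tracelessPart (hP i)
  rw [tracelessPart, sub_eq_zero] at h0
  set c := opTrace (Cspace m) V₁.starProjection / (Module.finrank ℂ (Cspace m) : ℂ)
  have hn₁ : Nontrivial V₁ := Module.nontrivial_of_finrank_pos (R := ℂ) (by omega)
  have hn₂ : Nontrivial V₁ᗮ := Module.nontrivial_of_finrank_pos (R := ℂ) (by omega)
  obtain ⟨v, hv⟩ := exists_ne (0 : V₁)
  obtain ⟨v', hv'⟩ := exists_ne (0 : V₁ᗮ)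
  have e1 : (v : Cspace m) = c • (v : Cspace m) := by
    conv_lhs => rw [← Submodule.starProjection_eq_self_iff.2 v.2, h0]
    rfl
  have e2 : 0 = c • (v' : Cspace m) := by
    rw [← (Submodule.starProjection_apply_eq_zero_iff V₁).2 v'.2, h0]
    rfl
  have hc : c = 0 := by
    refine (smul_eq_zero.1 e2.symm).resolve_right fun h => hv' (Subtype.ext h)
  rw [hc, zero_smul] at e1
  exact hv (Subtype.ext e1)

end Decomposable

/-! ### Affine charts of the orbits `𝒪_t`. -/

theorem hasFDerivAt_zero_of_even {E F : Type*} [NormedAddCommGroup E] [NormedSpace ℝ E]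
    [NormedAddCommGroup F] [NormedSpace ℝ F] {f : E → F} (hf : DifferentiableAt ℝ f 0)
    (heven : ∀ x, f (-x) = f x) : HasFDerivAt f (0 : E →L[ℝ] F) 0 := by
  obtain ⟨f', hf'⟩ := hf
  have h1 : HasFDerivAt (fun x => f (-x)) (f'.comp (-ContinuousLinearMap.id ℝ E)) 0 :=
    HasFDerivAt.comp (g := f) (f := fun x => -x) 0 (by rwa [neg_zero]) (hasFDerivAt_id 0).neg
  simp only [heven] at h1
  have h2 : f' = 0 := by
    ext1 v
    have h3 : f' v = f' (-v) := DFunLike.congr_fun (hf'.unique h1) v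
    rw [map_neg] at h3
    have h4 : (2 : ℝ) • f' v = 0 := by rw [two_smul, ← sub_neg_eq_add, ← h3, sub_self]
    exact (smul_eq_zero.1 h4).resolve_left two_ne_zero
  rwa [h2] at hf'

section OrbitChart

variable {V : Type*} [NormedAddCommGroup V] [InnerProductSpace ℂ V]

/-- `rankOne` is conjugate-linear in its second argument, so bilinearity, and with it smoothness,
holds only over `ℝ`. -/
theorem isBoundedBilinearMap_rankOne :
    IsBoundedBilinearMap ℝ fun p : V × V => (rankOne ℂ p.1 p.2 : V →L[ℂ] V) where
  add_left x₁ x₂ y := by simp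
  smul_left c x y := by
    ext v
    exact smul_comm (inner ℂ y v : ℂ) c x
  add_right x y₁ y₂ := by simp
  smul_right c x y := by
    ext v
    change inner ℂ (c • y) v • x = c • (inner ℂ y v • x)
    rw [← Complex.coe_smul, inner_smul_left, Complex.conj_ofReal, mul_smul, Complex.coe_smul]
  bound := ⟨1, one_pos, fun x y => by simp⟩

/-- The parametrization of the orbit `𝒪_t` around `t w ⊗ w*` by the orthogonal complement
of `w`. -/
def orbitParam (t : ℝ) (w : V) (u : (ℂ ∙ w)ᗮ) : V →L[ℂ] V :=
  -- For a unit vector `w` orthogonal to `u`, the denominator is `‖w + u‖ ^ 2`, so the factor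
  -- normalizes the vector.
  (t / (1 + ‖u‖ ^ 2)) • rankOne ℂ (w + u) (w + u)

/-- The coordinate on the orbit `𝒪_t` around `t w ⊗ w*`. -/
def orbitCoord (w : V) (X : V →L[ℂ] V) : (ℂ ∙ w)ᗮ :=
  -- `X w` spans the line of the edge; dividing by its component along `w` puts it in the affine
  -- hyperplane `w + wᗮ`.
  (ℂ ∙ w)ᗮ.orthogonalProjectionOnto ((inner ℂ w (X w))⁻¹ • X w)

variable {t : ℝ} {w : V}

theorem orbitParam_zero : orbitParam t w 0 = (t : ℂ) • rankOne ℂ w w := by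
  simp [orbitParam]

theorem inner_left_of_orthogonal (u : (ℂ ∙ w)ᗮ) : inner ℂ w (u : V) = 0 :=
  Submodule.mem_orthogonal_singleton_iff_inner_right.1 u.2

theorem inner_right_of_orthogonal (u : (ℂ ∙ w)ᗮ) : inner ℂ (u : V) w = 0 :=
  Submodule.mem_orthogonal_singleton_iff_inner_left.1 u.2

theorem inner_self_of_unit (hw : ‖w‖ = 1) : inner ℂ w w = 1 := by
  rw [inner_self_eq_norm_sq_to_K, hw]
  simp

theorem norm_add_sq_of_orthogonal (hw : ‖w‖ = 1) (u : (ℂ ∙ w)ᗮ) : ‖w + u‖ ^ 2 = 1 + ‖u‖ ^ 2 := by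
  have := norm_add_sq_eq_norm_sq_add_norm_sq_of_inner_eq_zero w (u : V) (inner_left_of_orthogonal u)
  simp only [← sq, hw, one_pow] at this
  exact this

theorem rankOne_eq_smul_of_norm_sq {y : V} {c : ℝ} (hy : ‖y‖ ^ 2 = c) (t : ℝ) :
    (t / c) • rankOne ℂ y y = (t : ℂ) • rankOne ℂ ((‖y‖⁻¹ : ℝ) • y) ((‖y‖⁻¹ : ℝ) • y) := by
  have h := isBoundedBilinearMap_rankOne (V := V)
  have h1 := h.smul_left ‖y‖⁻¹ y ((‖y‖⁻¹ : ℝ) • y)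
  have h2 := h.smul_right ‖y‖⁻¹ y y
  simp only at h1 h2
  rw [h1, h2, Complex.coe_smul, smul_smul, smul_smul, ← hy]
  congr 1
  field_simp

theorem orbitParam_mem_edgeOrbit (hw : ‖w‖ = 1) (u : (ℂ ∙ w)ᗮ) :
    orbitParam t w u ∈ edgeOrbit V t := by
  have h1 := norm_add_sq_of_orthogonal hw u
  have h0 : 0 < 1 + ‖u‖ ^ 2 := by positivity
  refine ⟨(‖w + u‖⁻¹ : ℝ) • (w + u), ?_, rankOne_eq_smul_of_norm_sq h1 t⟩
  rw [norm_smul, norm_inv, norm_norm]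
  refine inv_mul_cancel₀ fun h => ?_
  rw [h] at h1
  norm_num at h1
  exact h0.ne h1

theorem orbitCoord_orbitParam (ht : t ≠ 0) (hw : ‖w‖ = 1) (u : (ℂ ∙ w)ᗮ) :
    orbitCoord w (orbitParam t w u) = u := by
  have h0 : 0 < 1 + ‖u‖ ^ 2 := by positivity
  have h1 : orbitParam t w u w = ((t / (1 + ‖u‖ ^ 2) : ℝ) : ℂ) • (w + u) := by
    change (t / (1 + ‖u‖ ^ 2)) • (inner ℂ (w + u) w • (w + u)) = _
    rw [inner_add_left, inner_self_of_unit hw, inner_right_of_orthogonal, add_zero, one_smul,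
      Complex.coe_smul]
  have h2 : inner ℂ w (w + u) = 1 := by
    rw [inner_add_right, inner_self_of_unit hw, inner_left_of_orthogonal, add_zero]
  have h3 : ((t / (1 + ‖u‖ ^ 2) : ℝ) : ℂ) ≠ 0 := by exact_mod_cast div_ne_zero ht h0.ne'
  rw [orbitCoord, h1, inner_smul_right, h2, mul_one, smul_smul, inv_mul_cancel₀ h3, one_smul,
    map_add, Submodule.orthogonalProjectionOnto_mem_subspace_eq_self,
    Submodule.orthogonalProjectionOnto_eq_zero_iff.2
      (Submodule.le_orthogonal_orthogonal _ (Submodule.mem_span_singleton_self w)), zero_add]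

/-- This is the affine chart of projective space: the line of `v` meets `w + wᗮ` exactly when `(w,
v) ≠ 0`, which is what `hXw` says. -/
theorem orbitParam_orbitCoord (ht : t ≠ 0) (hw : ‖w‖ = 1) {X : V →L[ℂ] V} (hX : X ∈ edgeOrbit V t)
    (hXw : inner ℂ w (X w) ≠ 0) : orbitParam t w (orbitCoord w X) = X := by
  obtain ⟨v, hv, rfl⟩ := hX
  have h1 : ((t : ℂ) • rankOne ℂ v v) w = (t : ℂ) • (inner ℂ v w • v) := rfl
  rw [h1, inner_smul_right, inner_smul_right] at hXw
  have hwv : inner ℂ w v ≠ 0 := fun h => hXw (by rw [h, mul_zero, mul_zero])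
  have hvw : inner ℂ v w ≠ 0 := fun h => hXw (by rw [h, zero_mul, mul_zero])
  have ht' : (t : ℂ) ≠ 0 := by exact_mod_cast ht
  have h2 : (inner ℂ w (((t : ℂ) • rankOne ℂ v v) w))⁻¹ • ((t : ℂ) • rankOne ℂ v v) w =
      (inner ℂ w v)⁻¹ • v := by
    rw [h1, inner_smul_right, inner_smul_right, smul_smul, smul_smul]
    congr 1
    field_simp
  have h3 : w + (orbitCoord w ((t : ℂ) • rankOne ℂ v v) : V) = (inner ℂ w v)⁻¹ • v := by
    rw [orbitCoord, h2, ← Submodule.starProjection_apply, Submodule.starProjection_orthogonal_val,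
      Submodule.starProjection_unit_singleton ℂ hw, inner_smul_right, inv_mul_cancel₀ hwv, one_smul,
      add_sub_cancel]
  have h4 := norm_add_sq_of_orthogonal hw (orbitCoord w ((t : ℂ) • rankOne ℂ v v))
  rw [orbitParam, ← h4, h3, norm_smul, hv, mul_one, norm_inv]
  ext x
  change (t / (‖inner ℂ w v‖⁻¹) ^ 2) • (inner ℂ ((inner ℂ w v)⁻¹ • v) x • ((inner ℂ w v)⁻¹ • v)) =
    (t : ℂ) • (inner ℂ v x • v)
  rw [inner_smul_left, smul_smul, smul_smul, ← Complex.coe_smul, smul_smul]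
  congr 1
  have h5 : (‖(inner ℂ w v : ℂ)‖ : ℂ) ^ 2 = starRingEnd ℂ (inner ℂ w v) * inner ℂ w v :=
    (Complex.conj_mul' _).symm
  have h6 : starRingEnd ℂ (inner ℂ w v) ≠ 0 := (map_ne_zero _).2 hwv
  push_cast
  rw [inv_pow, h5, map_inv₀]
  field_simp

theorem contDiff_div_one_add_norm_sq {n : ℕ∞ω} :
    ContDiff ℝ n fun u : (ℂ ∙ w)ᗮ => t / (1 + ‖u‖ ^ 2) :=
  contDiff_const.div (contDiff_const.add (contDiff_norm_sq ℂ)) fun u => by positivity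

theorem contDiff_add_subtype {n : ℕ∞ω} : ContDiff ℝ n fun u : (ℂ ∙ w)ᗮ => (w + u, w + u) :=
  have h : ContDiff ℝ n fun u : (ℂ ∙ w)ᗮ => w + u :=
    contDiff_const.add (((ℂ ∙ w)ᗮ.subtypeL.restrictScalars ℝ).contDiff)
  h.prodMk h

theorem contDiff_orbitParam : ContDiff ℝ ω (orbitParam t w) :=
  have h : ContDiff ℝ ω fun u : (ℂ ∙ w)ᗮ => (rankOne ℂ (w + u) (w + u) : V →L[ℂ] V) :=
    ContDiff.comp (g := fun p : V × V => (rankOne ℂ p.1 p.2 : V →L[ℂ] V))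
      isBoundedBilinearMap_rankOne.contDiff contDiff_add_subtype
  contDiff_div_one_add_norm_sq.smul h

theorem exists_hasFDerivAt_orbitParam (t : ℝ) (w : V) : ∃ L : (ℂ ∙ w)ᗮ →L[ℝ] (V →L[ℂ] V),
    HasFDerivAt (orbitParam t w) L 0 ∧
      ∀ u, L u = t • (rankOne ℂ w (u : V) + rankOne ℂ (u : V) w) := by
  -- The normalizing factor is even in `u`, so it contributes nothing to first order.
  have h1 : HasFDerivAt (fun u : (ℂ ∙ w)ᗮ => t / (1 + ‖u‖ ^ 2)) (0 : (ℂ ∙ w)ᗮ →L[ℝ] ℝ) 0 :=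
    hasFDerivAt_zero_of_even (contDiff_div_one_add_norm_sq.differentiable one_ne_zero 0)
      fun u => by rw [norm_neg]
  have h2 : HasFDerivAt (fun u : (ℂ ∙ w)ᗮ => w + (u : V)) ((ℂ ∙ w)ᗮ.subtypeL.restrictScalars ℝ) 0 :=
    ((ℂ ∙ w)ᗮ.subtypeL.restrictScalars ℝ).hasFDerivAt.const_add w
  have h3 := (isBoundedBilinearMap_rankOne.hasFDerivAt
    (w + ((0 : (ℂ ∙ w)ᗮ) : V), w + ((0 : (ℂ ∙ w)ᗮ) : V))).comp
    (f := fun u : (ℂ ∙ w)ᗮ => (w + (u : V), w + (u : V))) 0 (h2.prodMk h2)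
  let J := (ℂ ∙ w)ᗮ.subtypeL.restrictScalars ℝ
  refine ⟨t • (isBoundedBilinearMap_rankOne.deriv (w, w)).comp (J.prod J),
    (h1.smul h3).congr_fderiv ?_, fun u => rfl⟩
  ext1 u
  change (t / (1 + ‖(0 : (ℂ ∙ w)ᗮ)‖ ^ 2)) • (rankOne ℂ (w + ((0 : (ℂ ∙ w)ᗮ) : V)) (u : V) +
    rankOne ℂ (u : V) (w + ((0 : (ℂ ∙ w)ᗮ) : V))) + (0 : ℝ) • _ =
    t • (rankOne ℂ w (u : V) + rankOne ℂ (u : V) w)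
  rw [zero_smul, add_zero, norm_zero, Submodule.coe_zero, add_zero]
  norm_num

theorem contDiffAt_orbitCoord {X : V →L[ℂ] V} (hX : inner ℂ w (X w) ≠ 0) :
    ContDiffAt ℝ ω (orbitCoord w) X := by
  have h1 : ContDiffAt ℝ ω (fun Y : V →L[ℂ] V => Y w) X :=
    ((ContinuousLinearMap.apply ℂ V w).restrictScalars ℝ).contDiff.contDiffAt
  have h2 : ContDiffAt ℝ ω (fun Y : V →L[ℂ] V => (inner ℂ w (Y w) : ℂ)) X :=
    (((innerSL ℂ w).comp (ContinuousLinearMap.apply ℂ V w)).restrictScalars ℝ).contDiff.contDiffAt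
  exact ((ℂ ∙ w)ᗮ.orthogonalProjectionOnto.restrictScalars ℝ).contDiff.contDiffAt.comp X
    ((h2.inv hX).smul h1)

theorem finrank_orthogonal_singleton [FiniteDimensional ℂ V] (hw : ‖w‖ = 1) :
    Module.finrank ℝ (ℂ ∙ w)ᗮ + 2 = 2 * Module.finrank ℂ V := by
  have h1 := Submodule.finrank_add_finrank_orthogonal (ℂ ∙ w)
  rw [finrank_span_singleton (by rintro rfl; simp at hw)] at h1
  rw [finrank_real_of_complex]
  omega

end OrbitChart

/-! ### The moment map and its regularity at irreducible polygons. -/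

theorem opTrace_of_mem_edgeOrbit {V : Type*} [NormedAddCommGroup V] [InnerProductSpace ℂ V]
    [FiniteDimensional ℂ V] {t : ℝ} {X : V →L[ℂ] V} (hX : X ∈ edgeOrbit V t) :
    opTrace V X = t := by
  obtain ⟨v, hv, rfl⟩ := hX
  rw [map_smul, opTrace_rankOne, inner_self_of_unit hv, smul_eq_mul, mul_one]

theorem contDiff_sum_orbitParam {V : Type*} [NormedAddCommGroup V] [InnerProductSpace ℂ V]
    {ι : Type*} [Fintype ι] {r : ι → ℝ} {w : ι → V} :
    ContDiff ℝ ω fun u : Π i, (ℂ ∙ w i)ᗮ => ∑ i, orbitParam (r i) (w i) (u i) :=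
  ContDiff.sum fun i _ => contDiff_orbitParam.comp
    (ContinuousLinearMap.proj (R := ℝ) (φ := fun i => (ℂ ∙ w i)ᗮ) i).contDiff

theorem isSelfAdjoint_rankOne_add {V : Type*} [NormedAddCommGroup V] [InnerProductSpace ℂ V]
    [CompleteSpace V] (x y : V) :
    IsSelfAdjoint (rankOne ℂ x y + rankOne ℂ y x) := by
  rw [IsSelfAdjoint, star_add, ContinuousLinearMap.star_eq_adjoint,
    ContinuousLinearMap.star_eq_adjoint, adjoint_rankOne, adjoint_rankOne, add_comm]

theorem finrank_pi_orthogonal_singleton {V : Type*} [NormedAddCommGroup V] [InnerProductSpace ℂ V]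
    [FiniteDimensional ℂ V] {ι : Type*} [Fintype ι] {w : ι → V} (hw : ∀ i, ‖w i‖ = 1) :
    Module.finrank ℝ (Π i, (ℂ ∙ w i)ᗮ) = 2 * (Module.finrank ℂ V - 1) * Fintype.card ι := by
  have h1 : ∀ i, Module.finrank ℝ (ℂ ∙ w i)ᗮ = 2 * (Module.finrank ℂ V - 1) := fun i => by
    have := finrank_orthogonal_singleton (hw i)
    omega
  rw [Module.finrank_pi_fintype, Finset.sum_congr rfl fun i _ => h1 i, Finset.sum_const,
    Finset.card_univ, smul_eq_mul, mul_comm]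

section MomentMap

variable {V : Type*} [NormedAddCommGroup V] [InnerProductSpace ℂ V] [FiniteDimensional ℂ V]
  [CompleteSpace V]

/-- The trace form on traceless Hermitian operators represents every linear functional. -/
theorem exists_eq_re_opTrace_mul (f : Module.Dual ℝ (tracelessHermitian V)) :
    ∃ X : tracelessHermitian V, ∀ Y : tracelessHermitian V,
      f Y = (opTrace V ((X : V →L[ℂ] V) * Y)).re := by
  let τ : tracelessHermitian V →ₗ[ℝ] Module.Dual ℝ (tracelessHermitian V) :=
    LinearMap.mk₂ ℝ (fun X Y => (opTrace V ((X : V →L[ℂ] V) * Y)).re)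
      (fun X X' Y => by simp [add_mul])
      (fun c X Y => by
        rw [Submodule.coe_smul, smul_mul_assoc, ← Complex.coe_smul, map_smul]
        simp)
      (fun X Y Y' => by simp [mul_add])
      (fun c X Y => by
        rw [Submodule.coe_smul, mul_smul_comm, ← Complex.coe_smul, map_smul]
        simp)
  have hτ : Injective τ := by
    refine (injective_iff_map_eq_zero _).2 fun X hX => ?_
    have h1 : (opTrace V ((X : V →L[ℂ] V) * X)).re = 0 := LinearMap.congr_fun hX X
    refine Subtype.ext (eq_zero_of_opTrace_star_mul_self ?_)
    rwa [(mem_tracelessHermitian.1 X.2).1.star_eq]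
  have : FiniteDimensional ℝ (V →L[ℂ] V) := FiniteDimensional.complexToReal _
  obtain ⟨X, hX⟩ := (LinearMap.injective_iff_surjective_of_finrank_eq_finrank
    Subspace.dual_finrank_eq.symm).1 hτ f
  exact ⟨X, fun Y => by rw [← hX]; rfl⟩

variable [Nontrivial V]

variable (V) in
/-- The projection to the traceless Hermitian operators. -/
def tracelessProj : (V →L[ℂ] V) →L[ℝ] tracelessHermitian V :=
  haveI : FiniteDimensional ℝ (V →L[ℂ] V) := FiniteDimensional.complexToReal _
  LinearMap.toContinuousLinearMap
    -- Taking the real part first extends the projection linearly to all operators.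
    { toFun := fun X => ⟨tracelessPart (realPart X : V →L[ℂ] V), tracelessPart_mem (realPart X).2⟩
      map_add' := fun X Y => by
        ext1
        simp only [tracelessPart, map_add, add_div, add_smul, AddSubgroup.coe_add,
          Submodule.coe_add]
        abel
      map_smul' := fun c X => by
        ext1
        have h : ((realPart (c • X) : selfAdjoint (V →L[ℂ] V)) : V →L[ℂ] V) =
            (c : ℂ) • (realPart X : V →L[ℂ] V) := by
          rw [map_smul, Complex.coe_smul]
          rfl
        simp only [tracelessPart, h, RingHom.id_apply, Submodule.coe_smul, smul_sub]
        rw [map_smul, smul_eq_mul, mul_div_assoc, mul_smul, Complex.coe_smul, Complex.coe_smul] }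

theorem tracelessProj_of_isSelfAdjoint {X : V →L[ℂ] V} (hX : IsSelfAdjoint X) :
    (tracelessProj V X : V →L[ℂ] V) = tracelessPart X := by
  change tracelessPart (realPart X : V →L[ℂ] V) = _
  rw [hX.coe_realPart]

theorem opTrace_mul_tracelessProj {X Z : V →L[ℂ] V} (hX : opTrace V X = 0) (hZ : IsSelfAdjoint Z) :
    opTrace V (X * (tracelessProj V Z : V →L[ℂ] V)) = opTrace V (X * Z) := by
  rw [tracelessProj_of_isSelfAdjoint hZ, tracelessPart, mul_sub, mul_smul_comm, mul_one, map_sub,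
    map_smul, hX, smul_zero, sub_zero]

variable {ι : Type*} [Fintype ι] {r : ι → ℝ} {w : ι → V}

/-- The traceless part of the sum of the edges, in local coordinates. -/
def momentMap (r : ι → ℝ) (w : ι → V) (u : Π i, (ℂ ∙ w i)ᗮ) : tracelessHermitian V :=
  tracelessProj V (∑ i, orbitParam (r i) (w i) (u i))

/-- The trace of `∑ x i` is already the total length, so only the traceless part of the closing
condition imposes equations. -/
theorem tracelessProj_sum_eq_zero_iff {x : ι → (V →L[ℂ] V)} (hx : ∀ i, x i ∈ edgeOrbit V (r i)) :
    tracelessProj V (∑ i, x i) = 0 ↔ x ∈ closedPolygons V r := by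
  have hs : IsSelfAdjoint (∑ i, x i) :=
    isSelfAdjoint_sum _ fun i _ => isSelfAdjoint_of_mem_edgeOrbit (hx i)
  have ht : opTrace V (∑ i, x i) = ((∑ i, r i : ℝ) : ℂ) := by
    rw [map_sum, Complex.ofReal_sum]
    exact Finset.sum_congr rfl fun i _ => opTrace_of_mem_edgeOrbit (hx i)
  rw [← Submodule.coe_eq_zero, tracelessProj_of_isSelfAdjoint hs, tracelessPart, sub_eq_zero, ht]
  change _ ↔ (∀ i, x i ∈ edgeOrbit V (r i)) ∧ _
  rw [and_iff_right hx, Complex.ofReal_div, Complex.ofReal_natCast]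
  rfl

theorem exists_hasFDerivAt_momentMap (r : ι → ℝ) (w : ι → V) :
    ∃ M' : (Π i, (ℂ ∙ w i)ᗮ) →L[ℝ] tracelessHermitian V, HasFDerivAt (momentMap r w) M' 0 ∧
      ∀ u, M' u = tracelessProj V
        (∑ i, r i • (rankOne ℂ (w i) (u i : V) + rankOne ℂ (u i : V) (w i))) := by
  choose L hL hLu using fun i => exists_hasFDerivAt_orbitParam (r i) (w i)
  have h1 : ∀ i, HasFDerivAt (fun u : Π i, (ℂ ∙ w i)ᗮ => orbitParam (r i) (w i) (u i))
      ((L i).comp (ContinuousLinearMap.proj (R := ℝ) (φ := fun i => (ℂ ∙ w i)ᗮ) i)) 0 := fun i =>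
    HasFDerivAt.comp (g := orbitParam (r i) (w i)) (f := fun u : Π i, (ℂ ∙ w i)ᗮ => u i) 0 (hL i)
      (ContinuousLinearMap.proj (R := ℝ) (φ := fun i => (ℂ ∙ w i)ᗮ) i).hasFDerivAt
  refine ⟨(tracelessProj V).comp (∑ i, (L i).comp
    (ContinuousLinearMap.proj (R := ℝ) (φ := fun i => (ℂ ∙ w i)ᗮ) i)),
    (tracelessProj V).hasFDerivAt.comp (0 : Π i, (ℂ ∙ w i)ᗮ)
      (HasFDerivAt.fun_sum fun i _ => h1 i), fun u => ?_⟩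
  change tracelessProj V ((∑ i, (L i).comp (ContinuousLinearMap.proj (R := ℝ)
    (φ := fun i => (ℂ ∙ w i)ᗮ) i)) u) = _
  rw [sum_apply]
  exact congrArg _ (Finset.sum_congr rfl fun i _ => hLu i (u i))

/-- The differential of the moment map at an irreducible tuple is surjective. -/
theorem surjective_of_isIrreducible (hr : ∀ i, r i ≠ 0) (hw : ∀ i, ‖w i‖ = 1)
    (hirr : IsIrreducible fun i => (r i : ℂ) • rankOne ℂ (w i) (w i))
    {M' : (Π i, (ℂ ∙ w i)ᗮ) →L[ℝ] tracelessHermitian V}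
    (hM' : ∀ u, M' u = tracelessProj V
        (∑ i, r i • (rankOne ℂ (w i) (u i : V) + rankOne ℂ (u i : V) (w i)))) :
    Surjective M' := by
  classical
  by_contra hns
  have hlt : LinearMap.range (M' : (Π i, (ℂ ∙ w i)ᗮ) →ₗ[ℝ] tracelessHermitian V) < ⊤ :=
    lt_top_iff_ne_top.2 fun h => hns (LinearMap.range_eq_top.1 h)
  -- A functional vanishing on the range is the trace pairing with some `X`; the aim is that `X`
  -- commutes with every edge and so is zero.
  obtain ⟨f, hf0, hf⟩ := Submodule.exists_le_ker_of_lt_top _ hlt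
  obtain ⟨X, hX⟩ := exists_eq_re_opTrace_mul f
  have hXs := (mem_tracelessHermitian.1 X.2).1
  have hXt := (mem_tracelessHermitian.1 X.2).2
  have hsym : ∀ v v', inner ℂ ((X : V →L[ℂ] V) v) v' = inner ℂ v ((X : V →L[ℂ] V) v') :=
    (ContinuousLinearMap.isSelfAdjoint_iff_isSymmetric.1 hXs)
  have h1 : ∀ i (v : (ℂ ∙ w i)ᗮ), (inner ℂ (v : V) ((X : V →L[ℂ] V) (w i))).re = 0 := by
    intro i v
    have h2 : f (M' (Pi.single i v)) = 0 := hf ⟨_, rfl⟩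
    have h3 : ∑ j, r j • (rankOne ℂ (w j) ((Pi.single i v : Π i, (ℂ ∙ w i)ᗮ) j : V) +
        rankOne ℂ ((Pi.single i v : Π i, (ℂ ∙ w i)ᗮ) j : V) (w j)) =
        r i • (rankOne ℂ (w i) (v : V) + rankOne ℂ (v : V) (w i)) := by
      rw [Finset.sum_eq_single i]
      · rw [Pi.single_eq_same]
      · intro j _ hj
        rw [Pi.single_eq_of_ne hj]
        simp
      · simp
    rw [hX, hM', h3, opTrace_mul_tracelessProj hXt
      ((IsSelfAdjoint.all (r i)).smul (isSelfAdjoint_rankOne_add _ _)), ← Complex.coe_smul,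
      mul_smul_comm, map_smul, mul_add, map_add, opTrace_mul_rankOne, opTrace_mul_rankOne,
      ← hsym (w i), ← inner_conj_symm ((X : V →L[ℂ] V) (w i))] at h2
    have h4 : (inner ℂ (v : V) ((X : V →L[ℂ] V) (w i)) +
        starRingEnd ℂ (inner ℂ (v : V) ((X : V →L[ℂ] V) (w i)))).re = 0 := by
      have h5 := h2
      rw [smul_eq_mul, Complex.re_ofReal_mul] at h5
      exact (mul_eq_zero.1 h5).resolve_left (hr i)
    rw [Complex.add_re, Complex.conj_re] at h4
    linarith
  have h2 : ∀ i, (X : V →L[ℂ] V) (w i) =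
      (inner ℂ (w i) ((X : V →L[ℂ] V) (w i)) : ℂ) • w i := by
    intro i
    -- Testing with the component of `X (w i)` orthogonal to `w i` yields its squared norm, so the
    -- component vanishes and `w i` is an eigenvector.
    have h3 := h1 i ((ℂ ∙ w i)ᗮ.orthogonalProjectionOnto ((X : V →L[ℂ] V) (w i)))
    rw [← Submodule.inner_orthogonalProjectionOnto_eq_of_mem_left, inner_self_eq_norm_sq_to_K] at h3
    have h4 : (ℂ ∙ w i)ᗮ.orthogonalProjectionOnto ((X : V →L[ℂ] V) (w i)) = 0 := by
      rw [← norm_eq_zero]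
      refine pow_eq_zero_iff two_ne_zero |>.1 ?_
      exact_mod_cast h3
    have h5 : (ℂ ∙ w i)ᗮ.starProjection ((X : V →L[ℂ] V) (w i)) = 0 := by
      rw [Submodule.starProjection_apply, h4, Submodule.coe_zero]
    rw [Submodule.starProjection_orthogonal_val, sub_eq_zero,
      Submodule.starProjection_unit_singleton ℂ (hw i)] at h5
    exact h5
  have hX0 : (X : V →L[ℂ] V) = 0 := by
    refine hirr X X.2 fun i => Commute.smul_right ?_ _
    have h4 := h2 i
    set c : ℂ := inner ℂ (w i) ((X : V →L[ℂ] V) (w i)) with hc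
    have hreal : starRingEnd ℂ c = c := by rw [hc, inner_conj_symm, hsym]
    ext v
    change (X : V →L[ℂ] V) (inner ℂ (w i) v • w i) = inner ℂ (w i) ((X : V →L[ℂ] V) v) • w i
    rw [map_smul, h4, ← hsym, h4, inner_smul_left, hreal, smul_smul, mul_comm]
  refine hf0 (LinearMap.ext fun Y => ?_)
  rw [hX, hX0, zero_mul, map_zero]
  rfl

theorem finrank_tracelessHermitian_le (hr : ∀ i, r i ≠ 0) {e : ι → (V →L[ℂ] V)}
    (he : ∀ i, e i ∈ edgeOrbit V (r i)) (hirr : IsIrreducible e) :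
    Module.finrank ℝ (tracelessHermitian V) ≤ 2 * (Module.finrank ℂ V - 1) * Fintype.card ι := by
  choose w hw hew using he
  obtain ⟨M', -, hM'u⟩ := exists_hasFDerivAt_momentMap r w
  rw [← finrank_pi_orthogonal_singleton hw]
  exact LinearMap.finrank_le_finrank_of_surjective (f := (M' : _ →ₗ[ℝ] tracelessHermitian V))
    (surjective_of_isIrreducible hr hw (funext hew ▸ hirr) hM'u)

/-- The irreducible closed polygons form a submanifold. -/
theorem exists_isStraightening_closedPolygons {T Z : Type*} [NormedAddCommGroup T] [NormedSpace ℝ T]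
    [FiniteDimensional ℝ T] [NormedAddCommGroup Z] [NormedSpace ℝ Z] [FiniteDimensional ℝ Z]
    (hr : ∀ i, r i ≠ 0) {e : ι → (V →L[ℂ] V)} (he : e ∈ closedPolygons V r)
    (hirr : IsIrreducible e)
    (hT : 2 * (Module.finrank ℂ V - 1) * Fintype.card ι =
      Module.finrank ℝ T + Module.finrank ℝ (tracelessHermitian V))
    (hZ : Module.finrank ℝ (ι → (V →L[ℂ] V)) = Module.finrank ℝ T + Module.finrank ℝ Z) :
    ∃ φ : OpenPartialHomeomorph (ι → (V →L[ℂ] V)) (T × Z),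
      IsStraightening φ {x | x ∈ closedPolygons V r ∧ IsIrreducible x} e := by
  have : FiniteDimensional ℝ (V →L[ℂ] V) := FiniteDimensional.complexToReal _
  choose w hw hew using he.1
  have hew' : e = fun i => (r i : ℂ) • rankOne ℂ (w i) (w i) := funext hew
  obtain ⟨M', hM', hM'u⟩ := exists_hasFDerivAt_momentMap r w
  let P : (Π i, (ℂ ∙ w i)ᗮ) → ι → (V →L[ℂ] V) := fun u i => orbitParam (r i) (w i) (u i)
  let R : (ι → (V →L[ℂ] V)) → Π i, (ℂ ∙ w i)ᗮ := fun x i => orbitCoord (w i) (x i)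
  have hP : ContDiff ℝ ω P := contDiff_pi.2 fun i => contDiff_orbitParam.comp
    (ContinuousLinearMap.proj (R := ℝ) (φ := fun i => (ℂ ∙ w i)ᗮ) i).contDiff
  have hP0 : P 0 = e := by
    rw [hew']
    exact funext fun i => orbitParam_zero
  have hRP : ∀ u, R (P u) = u := fun u => funext fun i => orbitCoord_orbitParam (hr i) (hw i) (u i)
  have hne : ∀ i, inner ℂ (w i) (e i (w i)) ≠ (0 : ℂ) := by
    intro i
    rw [hew]
    change inner ℂ (w i) ((r i : ℂ) • (inner ℂ (w i) (w i) • w i)) ≠ (0 : ℂ)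
    rw [inner_self_of_unit (hw i), one_smul, inner_smul_right, inner_self_of_unit (hw i), mul_one]
    exact_mod_cast hr i
  have hR : ContDiffAt ℝ ω R e := contDiffAt_pi.2 fun i =>
    ContDiffAt.comp (g := orbitCoord (w i)) (f := fun x : ι → (V →L[ℂ] V) => x i) e
      (contDiffAt_orbitCoord (hne i))
      (ContinuousLinearMap.proj (R := ℝ) (φ := fun _ : ι => V →L[ℂ] V) i).contDiff.contDiffAt
  have hPo : ∀ u i, P u i ∈ edgeOrbit V (r i) := fun u i => orbitParam_mem_edgeOrbit (hw i) (u i)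
  have hM0 : momentMap r w 0 = 0 := by
    have h1 := (tracelessProj_sum_eq_zero_iff he.1).2 he
    rwa [← hP0] at h1
  -- Irreducibility is open, so nearby zeros of the moment map stay in the set being straightened.
  have hPirr : ∀ᶠ u in 𝓝 0, IsIrreducible (P u) := by
    have h1 : ∀ᶠ x in 𝓝 (P 0), IsIrreducible x := by
      rw [hP0]
      exact isOpen_isIrreducible.mem_nhds hirr
    exact hP.continuous.continuousAt.eventually h1
  have hne' : ∀ᶠ x : ι → (V →L[ℂ] V) in 𝓝 e, ∀ i, inner ℂ (w i) (x i (w i)) ≠ (0 : ℂ) := by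
    refine eventually_all.2 fun i => ContinuousAt.eventually_ne ?_ (hne i)
    exact (((innerSL ℂ (w i)).comp (ContinuousLinearMap.apply ℂ V (w i))).continuous.comp
      (continuous_apply i)).continuousAt
  refine exists_isStraightening (P := P) (R := R) (M := momentMap r w) hP.contDiffAt hP0 hR
    (by rw [← hP0, hRP]) (Eventually.of_forall hRP)
    ((tracelessProj V).contDiff.comp contDiff_sum_orbitParam).contDiffAt hM'
    (surjective_of_isIrreducible hr hw (hew' ▸ hirr) hM'u) hM0 ?_ ?_ ?_ hZ
  · filter_upwards [hPirr] with u hu h0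
    exact ⟨(tracelessProj_sum_eq_zero_iff (hPo u)).1 h0, hu⟩
  · filter_upwards [hne'] with x hx hxX
    have h1 : P (R x) = x :=
      funext fun i => orbitParam_orbitCoord (hr i) (hw i) (hxX.1.1 i) (hx i)
    refine ⟨h1, ?_⟩
    have h2 := (tracelessProj_sum_eq_zero_iff hxX.1.1).2 hxX.1
    rwa [← h1] at h2
  · rw [finrank_pi_orthogonal_singleton hw, hT]

end MomentMap

/-! ### The conjugation action of the unitary group. -/

section UnitaryAction

variable {m : ℕ}

/-- The unitary group acts on operators by conjugation. -/
instance : SMul (U m) (Cspace m →L[ℂ] Cspace m) := ⟨conj⟩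

instance : MulAction (U m) (Cspace m →L[ℂ] Cspace m) where
  one_smul := conj_one
  mul_smul := conj_mul

/-- The unitary group acts on tuples of operators by simultaneous conjugation. -/
instance {n : ℕ} : SMul (U m) (Fin n → (Cspace m →L[ℂ] Cspace m)) := ⟨fun g x i => g • x i⟩

instance {n : ℕ} : MulAction (U m) (Fin n → (Cspace m →L[ℂ] Cspace m)) where
  one_smul x := funext fun i => one_smul (U m) (x i)
  mul_smul g h x := funext fun i => mul_smul g h (x i)

/-- A unitary matrix as a unitary operator. -/
def opUnitary (g : U m) : unitary (Cspace m →L[ℂ] Cspace m) :=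
  ⟨toOp (g : Matrix (Fin (m + 1)) (Fin (m + 1)) ℂ), Unitary.map_mem toOp g.2⟩

theorem smul_operator (g : U m) (X : Cspace m →L[ℂ] Cspace m) :
    g • X = (opUnitary g : Cspace m →L[ℂ] Cspace m) * X *
      star (opUnitary g : Cspace m →L[ℂ] Cspace m) :=
  congrArg (toOp (g : Matrix (Fin (m + 1)) (Fin (m + 1)) ℂ) * X * ·) (map_star toOp _)

theorem opUnitary_one : opUnitary (1 : U m) = 1 :=
  Subtype.ext (map_one toOp)

theorem opUnitary_surjective : Surjective (opUnitary (m := m)) := fun u =>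
  ⟨⟨toOp.symm (u : Cspace m →L[ℂ] Cspace m), Unitary.map_mem toOp.symm u.2⟩,
    Subtype.ext (toOp.apply_symm_apply _)⟩

theorem continuous_opUnitary : Continuous (opUnitary (m := m)) := by
  have h : Continuous (toOp : Matrix (Fin (m + 1)) (Fin (m + 1)) ℂ → _) :=
    LinearMap.continuous_of_finiteDimensional (toOp (m := m)).toAlgEquiv.toLinearMap
  exact (h.comp continuous_subtype_val).subtype_mk _

instance : CompactSpace (U m) := by
  refine isCompact_iff_compactSpace.1 ?_
  have h : IsCompact (univ.pi fun _ => univ.pi fun _ => Metric.closedBall 0 1 :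
      Set (Matrix (Fin (m + 1)) (Fin (m + 1)) ℂ)) :=
    isCompact_univ_pi fun _ => isCompact_univ_pi fun _ => isCompact_closedBall _ _
  refine h.of_isClosed_subset
    (isClosed_unitary (R := Matrix (Fin (m + 1)) (Fin (m + 1)) ℂ)) ?_
  intro g hg i _ j _
  rw [mem_closedBall_zero_iff]
  exact entry_norm_bound_of_unitary hg i j

instance : ContinuousSMul (U m) (Cspace m →L[ℂ] Cspace m) where
  continuous_smul := by
    have h : Continuous fun g : U m => (opUnitary g : Cspace m →L[ℂ] Cspace m) :=
      continuous_subtype_val.comp continuous_opUnitary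
    exact ((h.comp continuous_fst).mul continuous_snd).mul (h.comp continuous_fst.inv)

instance {n : ℕ} : ContinuousSMul (U m) (Fin n → (Cspace m →L[ℂ] Cspace m)) where
  continuous_smul := continuous_pi fun i => by
    have h : Continuous fun p : U m × (Fin n → (Cspace m →L[ℂ] Cspace m)) => p.2 i :=
      (continuous_apply i).comp continuous_snd
    exact continuous_smul.comp (continuous_fst.prodMk h)

theorem smul_operator_eq_self_iff {g : U m} {X : Cspace m →L[ℂ] Cspace m} :
    g • X = X ↔ Commute (opUnitary g : Cspace m →L[ℂ] Cspace m) X := by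
  have h1 := Unitary.star_mul_self_of_mem (opUnitary g).2
  have h2 := Unitary.mul_star_self_of_mem (opUnitary g).2
  rw [smul_operator]
  constructor
  · intro h
    change _ * X = X * _
    conv_rhs => rw [← h]
    rw [mul_assoc, h1, mul_one]
  · intro h
    rw [h.eq, mul_assoc, h2, mul_one]

theorem contDiff_smul_tuple {n : ℕ} (g : U m) :
    ContDiff ℝ ∞ fun x : Fin n → (Cspace m →L[ℂ] Cspace m) => g • x := by
  refine contDiff_pi.2 fun i => ?_
  change ContDiff ℝ ∞ fun x : Fin n → (Cspace m →L[ℂ] Cspace m) => g • x i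
  simp only [smul_operator]
  exact (contDiff_const.mul
    (ContinuousLinearMap.proj (R := ℝ) (φ := fun _ : Fin n => Cspace m →L[ℂ] Cspace m) i).contDiff).mul
      contDiff_const

theorem exists_specialUnitary_eq_smul (g : U m) : ∃ (h : SU m) (z : ℂ), star z * z = 1 ∧
    (h : Matrix (Fin (m + 1)) (Fin (m + 1)) ℂ) = z • (g : Matrix (Fin (m + 1)) (Fin (m + 1)) ℂ) := by
  have hd := Matrix.det_of_mem_unitary g.2
  -- The determinant of `z • g` is `z ^ (m + 1)` times that of `g`, so `z` is a root of the inverse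
  -- determinant, here its conjugate.
  obtain ⟨z, hz⟩ := IsAlgClosed.exists_pow_nat_eq
    (star (g : Matrix (Fin (m + 1)) (Fin (m + 1)) ℂ).det) m.succ_pos
  have hn : ‖(g : Matrix (Fin (m + 1)) (Fin (m + 1)) ℂ).det‖ = 1 := CStarRing.norm_of_mem_unitary hd
  have hz1 : ‖z‖ = 1 := by
    rw [← pow_eq_one_iff_of_nonneg (norm_nonneg z) m.succ_ne_zero, ← norm_pow, hz, norm_star, hn]
  have hz2 : star z * z = 1 := by
    rw [Complex.star_def, mul_comm, Complex.mul_conj, Complex.normSq_eq_norm_sq, hz1]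
    simp
  refine ⟨⟨z • (g : Matrix (Fin (m + 1)) (Fin (m + 1)) ℂ), Matrix.mem_specialUnitaryGroup_iff.2
    ⟨?_, ?_⟩⟩, z, hz2, rfl⟩
  · rw [Matrix.mem_unitaryGroup_iff', star_smul, smul_mul_smul_comm, hz2, one_smul]
    exact Matrix.UnitaryGroup.star_mul_self g
  · rw [Matrix.det_smul, Fintype.card_fin, hz]
    exact (Unitary.mem_iff.1 hd).1

theorem smul_operator_eq_of_eq_smul {g h : U m} {z : ℂ} (hz : star z * z = 1)
    (hgh : (h : Matrix (Fin (m + 1)) (Fin (m + 1)) ℂ) =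
      z • (g : Matrix (Fin (m + 1)) (Fin (m + 1)) ℂ)) (X : Cspace m →L[ℂ] Cspace m) :
    h • X = g • X := by
  have h1 : (opUnitary h : Cspace m →L[ℂ] Cspace m) =
      z • (opUnitary g : Cspace m →L[ℂ] Cspace m) := by
    change toOp _ = z • toOp _
    rw [hgh, map_smul]
  rw [smul_operator, smul_operator, h1, star_smul, smul_mul_assoc, smul_mul_smul_comm, mul_comm z,
    hz, one_smul]

/-- The unitary operators span all operators. -/
theorem commute_of_forall_unitary {Y : Cspace m →L[ℂ] Cspace m}
    (h : ∀ u : unitary (Cspace m →L[ℂ] Cspace m), Commute Y u) (X : Cspace m →L[ℂ] Cspace m) :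
    Commute Y X := by
  have hX : X ∈ Submodule.span ℂ (unitary (Cspace m →L[ℂ] Cspace m) : Set _) := by
    rw [CStarAlgebra.span_unitary]
    trivial
  induction hX using Submodule.span_induction with
  | mem u hu => exact h ⟨u, hu⟩
  | zero => exact Commute.zero_right Y
  | add x y _ _ hx hy => exact hx.add_right hy
  | smul c x _ hx => exact hx.smul_right c

end UnitaryAction

/-! ### Stabilizers and the topology of the quotient. -/

section PolygonAction

variable {m n : ℕ} {r : Fin n → ℝ}

/-- The inclusion of the special unitary group. -/
def toU (g : SU m) : U m :=
  Submonoid.inclusion (Matrix.specialUnitaryGroup_le_unitaryGroup :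
      Matrix.specialUnitaryGroup (Fin (m + 1)) ℂ ≤ Matrix.unitaryGroup (Fin (m + 1)) ℂ) g

theorem specialUnitary_smul_polygon (g : SU m) (e : ClosedPolygon m r) : g • e = toU g • e := rfl

theorem coe_smul_polygon (g : U m) (e : ClosedPolygon m r) : (g • e).1 = g • e.1 := rfl

theorem proj_eq_proj_iff {e e' : ClosedPolygon m r} :
    proj m r e = proj m r e' ↔ ∃ g : U m, g • e = e' := by
  refine Quotient.eq.trans ?_
  rw [MulAction.orbitRel_apply]
  constructor
  · rintro ⟨g, hg⟩
    exact ⟨g⁻¹, by rw [← hg, inv_smul_smul]⟩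
  · rintro ⟨g, hg⟩
    exact ⟨g⁻¹, by rw [← hg]; exact inv_smul_smul g e⟩

theorem proj_eq_proj_iff_specialUnitary {e e' : ClosedPolygon m r} :
    proj m r e = proj m r e' ↔ ∃ g : SU m, g • e = e' := by
  rw [proj_eq_proj_iff]
  constructor
  · rintro ⟨g, rfl⟩
    obtain ⟨h, z, hz, hh⟩ := exists_specialUnitary_eq_smul g
    refine ⟨h, Subtype.ext (funext fun i => ?_)⟩
    exact smul_operator_eq_of_eq_smul (h := toU h) hz hh (e.1 i)
  · rintro ⟨g, rfl⟩
    exact ⟨toU g, rfl⟩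

/-- An element fixing `e` commutes with the edges, so it is scalar by Schur's lemma. A central
element commutes with every unitary matrix, since each is a scalar multiple of a special unitary
one, and hence with every operator. -/
theorem stabilizer_eq_center {e : ClosedPolygon m r} (h : IsIrreducible e.1) :
    MulAction.stabilizer (SU m) e = Subgroup.center (SU m) := by
  ext g
  have hg : g ∈ MulAction.stabilizer (SU m) e ↔
      ∀ i, Commute (opUnitary (toU g) : Cspace m →L[ℂ] Cspace m) (e.1 i) := by
    rw [MulAction.mem_stabilizer_iff, specialUnitary_smul_polygon, Subtype.ext_iff,
      coe_smul_polygon, funext_iff]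
    exact forall_congr' fun i => smul_operator_eq_self_iff
  rw [hg, Subgroup.mem_center_iff]
  constructor
  · intro hc k
    obtain ⟨z, hz⟩ := h.exists_eq_smul_one (isSelfAdjoint_edge e) hc
    have h1 : (g : Matrix (Fin (m + 1)) (Fin (m + 1)) ℂ) = z • 1 := by
      refine (toOp (m := m)).injective ?_
      change toOp _ = toOp _
      rw [map_smul, map_one]
      exact hz
    refine Subtype.ext ?_
    change (k : Matrix (Fin (m + 1)) (Fin (m + 1)) ℂ) * g = g * k
    rw [h1, mul_smul_comm, smul_mul_assoc, mul_one, one_mul]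
  · intro hc i
    refine commute_of_forall_unitary (fun u => ?_) _
    obtain ⟨k, rfl⟩ := opUnitary_surjective u
    obtain ⟨k', z, hz, hk⟩ := exists_specialUnitary_eq_smul k
    have h1 : (k' : Matrix (Fin (m + 1)) (Fin (m + 1)) ℂ) * g = g * k' :=
      congrArg Subtype.val (hc k')
    have h2 : (k : Matrix (Fin (m + 1)) (Fin (m + 1)) ℂ) = star z • k' := by
      rw [hk, smul_smul, hz, one_smul]
    have h3 : (g : Matrix (Fin (m + 1)) (Fin (m + 1)) ℂ) * k = k * g := by
      rw [h2, mul_smul_comm, smul_mul_assoc, h1]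
    change toOp _ * toOp _ = toOp _ * toOp _
    rw [← map_mul, ← map_mul]
    exact congrArg toOp h3

instance : ContinuousSMul (U m) (ClosedPolygon m r) where
  continuous_smul := by
    refine Continuous.subtype_mk (f := fun p : U m × ClosedPolygon m r => p.1 • p.2.1) ?_
      fun p => (p.1 • p.2).2
    exact continuous_smul.comp (continuous_fst.prodMk (continuous_subtype_val.comp continuous_snd))

theorem isOpenQuotientMap_proj : IsOpenQuotientMap (proj m r) :=
  MulAction.isOpenQuotientMap_quotientMk

instance : SecondCountableTopology (ModuliSpace m r) :=
  ContinuousConstSMul.secondCountableTopology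

instance : T2Space (ModuliSpace m r) := by
  rw [t2Space_iff_of_isOpenQuotientMap isOpenQuotientMap_proj]
  -- The orbit relation is the projection of this closed set along the compact group, hence closed.
  have h1 : IsClosed {q : U m × (ClosedPolygon m r × ClosedPolygon m r) | q.1 • q.2.1 = q.2.2} :=
    isClosed_eq (by fun_prop) (by fun_prop)
  convert isClosedMap_snd_of_compactSpace _ h1 using 1
  ext q
  simp only [mem_ofPred_eq, mem_image, Prod.exists, exists_eq_right, proj_eq_proj_iff]

theorem isOpenQuotientMap_projRegular : IsOpenQuotientMap (projRegular m r) where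
  surjective := by
    rintro ⟨q, hq⟩
    obtain ⟨e, rfl⟩ := isOpenQuotientMap_proj.surjective q
    exact ⟨⟨e, fun he => hq ⟨e, he, rfl⟩⟩, rfl⟩
  continuous := (isOpenQuotientMap_proj.continuous.comp continuous_subtype_val).subtype_mk _
  isOpenMap := by
    rintro _ ⟨s, hs, rfl⟩
    refine ⟨proj m r '' s, isOpenQuotientMap_proj.isOpenMap s hs, ?_⟩
    ext ⟨q, hq⟩
    constructor
    · rintro ⟨e, he, rfl⟩
      exact ⟨⟨e, fun h => hq ⟨e, h, rfl⟩⟩, he, rfl⟩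
    · rintro ⟨e, he, h⟩
      exact ⟨e.1, he, congrArg Subtype.val h⟩

end PolygonAction

/-! ### Dimension counts and assembly of the charts. -/

section Main

variable {m n : ℕ} {r : Fin n → ℝ}

theorem isIrreducible_iff_not_isDecomposable (hn : 0 < n) (hr : ∀ i, 0 < r i)
    {e : ClosedPolygon m r} : IsIrreducible e.1 ↔ ¬ IsDecomposable e :=
  ⟨not_isDecomposable_of_isIrreducible, isIrreducible_of_not_isDecomposable hn hr⟩

theorem isDecomposable_smul_iff (g : U m) {e : ClosedPolygon m r} :
    IsDecomposable (g • e) ↔ IsDecomposable e := by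
  refine ⟨fun h => ?_, fun h => h.smul g⟩
  have := h.smul g⁻¹
  rwa [inv_smul_smul] at this

theorem smul_tuple_eq_of_stabilizes {e : ClosedPolygon m r} (he : IsIrreducible e.1) {g : U m}
    (hg : g • e.1 = e.1) (x : Fin n → (Cspace m →L[ℂ] Cspace m)) : g • x = x := by
  obtain ⟨z, hz⟩ := he.exists_eq_smul_one (isSelfAdjoint_edge e) fun i =>
    smul_operator_eq_self_iff.1 (congrFun hg i)
  refine funext fun i => smul_operator_eq_self_iff.2 ?_
  rw [hz]
  exact (Commute.one_left (x i)).smul_left z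

theorem exists_smul_eq_expConj (A : tracelessHermitian (Cspace m)) :
    ∃ g : U m, ∀ x : Fin n → (Cspace m →L[ℂ] Cspace m), expConj (A, x) = g • x := by
  obtain ⟨g, hg⟩ := opUnitary_surjective
    (selfAdjoint.expUnitary ⟨(A : Cspace m →L[ℂ] Cspace m), (mem_tracelessHermitian.1 A.2).1⟩)
  refine ⟨g, fun x => funext fun i => ?_⟩
  rw [expConj_eq_expUnitary, ← hg]
  exact (smul_operator g (x i)).symm

theorem eventually_exists_smul_eq_expConj {N : Set (tracelessHermitian (Cspace m))}
    (hN : N ∈ 𝓝 0) : ∀ᶠ g : U m in 𝓝 1, ∃ A ∈ N,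
      ∀ x : Fin n → (Cspace m →L[ℂ] Cspace m), g • x = expConj (A, x) := by
  have h1 : Tendsto (opUnitary (m := m)) (𝓝 1) (𝓝 1) := by
    have := (continuous_opUnitary (m := m)).tendsto 1
    rwa [opUnitary_one] at this
  filter_upwards [h1.eventually (eventually_exists_expConj (ι := Fin n) hN)] with g ⟨A, hA, h⟩
  refine ⟨A, hA, fun x => funext fun i => ?_⟩
  rw [← h x i]
  exact smul_operator g (x i)

theorem injective_of_isIrreducible {V : Type*} [NormedAddCommGroup V] [InnerProductSpace ℂ V]
    [CompleteSpace V] {ι : Type*} [Fintype ι] {e : ι → (V →L[ℂ] V)} (he : IsIrreducible e)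
    {D : tracelessHermitian V →L[ℝ] (ι → (V →L[ℂ] V))}
    (hD : ∀ A i, D A i = Complex.I • ((A : V →L[ℂ] V) * e i - e i * A)) : Injective D := by
  refine (injective_iff_map_eq_zero _).2 fun A hA => Subtype.ext (he _ A.2 fun i => ?_)
  have h1 := congrFun hA i
  rw [hD, Pi.zero_apply, smul_eq_zero_iff_right Complex.I_ne_zero, sub_eq_zero] at h1
  exact h1

theorem finrank_tuples : Module.finrank ℝ (Fin n → (Cspace m →L[ℂ] Cspace m)) =
    n * (2 * (m + 1) ^ 2) := by
  have h1 : Module.finrank ℂ (Cspace m →L[ℂ] Cspace m) = (m + 1) ^ 2 := by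
    rw [← (toOp (m := m)).toAlgEquiv.toLinearEquiv.finrank_eq, Module.finrank_matrix]
    simp [sq]
  rw [Module.finrank_pi_fintype, Finset.sum_const, Finset.card_univ, Fintype.card_fin, smul_eq_mul,
    finrank_real_of_complex, h1]

theorem irreducible_smul (hn : 0 < n) (hr : ∀ i, 0 < r i) {e : ClosedPolygon m r}
    (he : IsIrreducible e.1) (g : U m) : IsIrreducible (g • e).1 := by
  rwa [isIrreducible_iff_not_isDecomposable hn hr, isDecomposable_smul_iff,
    ← isIrreducible_iff_not_isDecomposable hn hr]

/-- The orbit of `e` stays among the irreducible polygons, so its tangent space embeds in `T`. -/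
theorem finrank_le_of_isStraightening (hn : 0 < n) (hr : ∀ i, 0 < r i) {T Z : Type*}
    [NormedAddCommGroup T] [NormedSpace ℝ T] [FiniteDimensional ℝ T] [NormedAddCommGroup Z]
    [NormedSpace ℝ Z] {e : ClosedPolygon m r} (he : IsIrreducible e.1)
    {φ : OpenPartialHomeomorph (Fin n → (Cspace m →L[ℂ] Cspace m)) (T × Z)}
    (hφ : IsStraightening φ {x | x ∈ closedPolygons (Cspace m) r ∧ IsIrreducible x} e.1) :
    Module.finrank ℝ (tracelessHermitian (Cspace m)) ≤ Module.finrank ℝ T := by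
  obtain ⟨D, hD, hDu⟩ := exists_hasFDerivAt_expConj e.1
  obtain ⟨φ', hφ'⟩ := (hφ.smooth.contDiffAt
    (φ.open_source.mem_nhds hφ.mem_source)).differentiableAt (by simp)
  obtain ⟨D', hD', -⟩ := hφ.exists_injective_derivative (expConj_zero _) (fun A => by
    obtain ⟨g, hg⟩ := exists_smul_eq_expConj (n := n) A
    rw [hg]
    exact ⟨(g • e).2, irreducible_smul hn hr he g⟩) hD (injective_of_isIrreducible he hDu) hφ'
  exact LinearMap.finrank_le_finrank_of_injective
    (f := (D' : tracelessHermitian (Cspace m) →ₗ[ℝ] T)) hD'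

theorem finrank_Cspace : Module.finrank ℂ (Cspace m) = m + 1 := by simp

theorem exists_isStraightening_polygon (hr : ∀ i, 0 < r i) {e : ClosedPolygon m r}
    (he : IsIrreducible e.1) {T Z : Type*} [NormedAddCommGroup T] [NormedSpace ℝ T]
    [FiniteDimensional ℝ T] [NormedAddCommGroup Z] [NormedSpace ℝ Z] [FiniteDimensional ℝ Z]
    (hT : 2 * m * n = Module.finrank ℝ T + Module.finrank ℝ (tracelessHermitian (Cspace m)))
    (hZ : Module.finrank ℝ (Fin n → (Cspace m →L[ℂ] Cspace m)) =
      Module.finrank ℝ T + Module.finrank ℝ Z) :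
    ∃ φ : OpenPartialHomeomorph (Fin n → (Cspace m →L[ℂ] Cspace m)) (T × Z),
      IsStraightening φ {x | x ∈ closedPolygons (Cspace m) r ∧ IsIrreducible x} e.1 := by
  refine exists_isStraightening_closedPolygons (fun i => (hr i).ne') e.2 he ?_ hZ
  rw [finrank_Cspace, Fintype.card_fin, Nat.add_sub_cancel, hT]

/-- The existence of one irreducible polygon makes the expected dimension of the quotient
nonnegative: the zero set near it has dimension `2mn - c`, with `c` the dimension of the traceless
Hermitian operators, and contains an orbit of dimension `c`. -/
theorem two_mul_finrank_le (hn : 0 < n) (hr : ∀ i, 0 < r i) {e : ClosedPolygon m r}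
    (he : IsIrreducible e.1) :
    2 * Module.finrank ℝ (tracelessHermitian (Cspace m)) ≤ 2 * m * n := by
  have h1 := finrank_tracelessHermitian_le (fun i => (hr i).ne') e.2.1 he
  rw [finrank_Cspace, Fintype.card_fin, Nat.add_sub_cancel] at h1
  have h2 : 2 * m * n ≤ Module.finrank ℝ (Fin n → (Cspace m →L[ℂ] Cspace m)) := by
    rw [finrank_tuples]
    -- The difference of the two sides is twice this product.
    nlinarith [Nat.zero_le (n * (m ^ 2 + m + 1))]
  generalize hc : Module.finrank ℝ (tracelessHermitian (Cspace m)) = c at h1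
  generalize hE : Module.finrank ℝ (Fin n → (Cspace m →L[ℂ] Cspace m)) = d at h2
  have hT : Module.finrank ℝ (EuclideanSpace ℝ (Fin (2 * m * n - c))) = 2 * m * n - c :=
    finrank_euclideanSpace_fin
  obtain ⟨φ, hφ⟩ := exists_isStraightening_polygon hr he
    (T := EuclideanSpace ℝ (Fin (2 * m * n - c)))
    (Z := EuclideanSpace ℝ (Fin (d - (2 * m * n - c))))
    (by rw [hT, hc]; omega) (by rw [hT, finrank_euclideanSpace_fin, hE]; omega)
  have h3 := finrank_le_of_isStraightening hn hr he hφ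
  rw [hT, hc] at h3
  omega

variable {X Q : Type} {j : X → ClosedPolygon m r} {p : X → Q}

/-- The map `j` stands for two cases: the inclusion of the non-decomposable polygons and, off the
walls, the identity of the space of all polygons. -/
theorem range_coe_eq (hn : 0 < n) (hr : ∀ i, 0 < r i) (hjr : range j = (decomposableSet m r)ᶜ) :
    range (fun x => (j x).1) = {x | x ∈ closedPolygons (Cspace m) r ∧ IsIrreducible x} := by
  ext x
  constructor
  · rintro ⟨y, rfl⟩
    have hy : j y ∈ range j := ⟨y, rfl⟩
    rw [hjr] at hy
    exact ⟨(j y).2, (isIrreducible_iff_not_isDecomposable hn hr).2 hy⟩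
  · rintro ⟨h1, h2⟩
    have h3 : (⟨x, h1⟩ : ClosedPolygon m r) ∈ range j := by
      rw [hjr]
      exact not_isDecomposable_of_isIrreducible h2
    obtain ⟨y, hy⟩ := h3
    exact ⟨y, congrArg Subtype.val hy⟩

theorem exists_quotientChart_polygon {B T Z : Type} [NormedAddCommGroup B] [NormedSpace ℝ B]
    [FiniteDimensional ℝ B] [NormedAddCommGroup T] [NormedSpace ℝ T] [FiniteDimensional ℝ T]
    [NormedAddCommGroup Z] [NormedSpace ℝ Z] [FiniteDimensional ℝ Z] (hn : 0 < n)
    (hr : ∀ i, 0 < r i) (hjr : range j = (decomposableSet m r)ᶜ)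
    (hp : ∀ y z, p y = p z ↔ ∃ g : U m, g • (j y).1 = (j z).1)
    (hG : ∀ (g : U m) (y : X), g • (j y).1 ∈ range fun x => (j x).1)
    (hT : 2 * m * n = Module.finrank ℝ T + Module.finrank ℝ (tracelessHermitian (Cspace m)))
    (hTB : Module.finrank ℝ T = Module.finrank ℝ B +
      Module.finrank ℝ (tracelessHermitian (Cspace m)))
    (hZ : Module.finrank ℝ (Fin n → (Cspace m →L[ℂ] Cspace m)) =
      Module.finrank ℝ T + Module.finrank ℝ Z) (x : X) :
    Nonempty (QuotientChart B (tracelessHermitian (Cspace m)) Z (fun x => (j x).1) p x) := by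
  have : FiniteDimensional ℝ (Cspace m →L[ℂ] Cspace m) := FiniteDimensional.complexToReal _
  have hx : IsIrreducible (j x).1 := by
    have h1 : (j x).1 ∈ range fun x => (j x).1 := ⟨x, rfl⟩
    rw [range_coe_eq hn hr hjr] at h1
    exact h1.2
  obtain ⟨φ, hφ⟩ := exists_isStraightening_polygon hr hx hT hZ
  rw [← range_coe_eq hn hr hjr] at hφ
  obtain ⟨D, hD, hDu⟩ := exists_hasFDerivAt_expConj (j x).1
  exact exists_quotientChart (G := U m) (i := fun x => (j x).1) hφ hp hG
    (fun g hg => smul_tuple_eq_of_stabilizes hx hg) contDiff_expConj.contDiffAt expConj_zero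
    exists_smul_eq_expConj (fun N hN => eventually_exists_smul_eq_expConj hN) hD
    (injective_of_isIrreducible hx hDu) hTB hZ

theorem finrank_euclidean_prod {C : Type*} [AddCommGroup C] [Module ℝ C] [FiniteDimensional ℝ C]
    (b : ℕ) : Module.finrank ℝ (EuclideanSpace ℝ (Fin b) × C) = b + Module.finrank ℝ C := by
  rw [Module.finrank_prod, finrank_euclideanSpace_fin]

theorem finrank_prod_euclidean {C : Type*} [AddCommGroup C] [Module ℝ C] [FiniteDimensional ℝ C]
    (b : ℕ) : Module.finrank ℝ (C × EuclideanSpace ℝ (Fin b)) = Module.finrank ℝ C + b := by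
  rw [Module.finrank_prod, finrank_euclideanSpace_fin]

/-- The space of non-decomposable polygons is a smooth manifold, and so is its quotient. -/
theorem exists_isSmoothQuotient (hn : 0 < n) (hr : ∀ i, 0 < r i) [TopologicalSpace X]
    [TopologicalSpace Q] [T2Space Q] [SecondCountableTopology Q]
    (hj : IsEmbedding j) (hjr : range j = (decomposableSet m r)ᶜ)
    (hp : IsOpenQuotientMap p) (hpj : ∀ y z, p y = p z ↔ proj m r (j y) = proj m r (j z)) :
    ∃ a b : ℕ, (Nonempty X →
        (a : ℤ) = 2 * m * n - ((m + 1) ^ 2 - 1) ∧ (b : ℤ) = 2 * m * (n - m - 2)) ∧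
      IsSmoothQuotient a b (fun x => (j x).1) p := by
  have : FiniteDimensional ℝ (Cspace m →L[ℂ] Cspace m) := FiniteDimensional.complexToReal _
  have hi : IsEmbedding fun x => (j x).1 := IsEmbedding.subtypeVal.comp hj
  have hpi : ∀ y z, p y = p z ↔ ∃ g : U m, g • (j y).1 = (j z).1 := fun y z => by
    rw [hpj, proj_eq_proj_iff]
    exact exists_congr fun g => Subtype.ext_iff
  have hirr : ∀ x, IsIrreducible (j x).1 := fun x => by
    have h1 : (j x).1 ∈ range fun x => (j x).1 := ⟨x, rfl⟩
    rw [range_coe_eq hn hr hjr] at h1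
    exact h1.2
  have hG : ∀ (g : U m) (y : X), g • (j y).1 ∈ range fun x => (j x).1 := fun g y => by
    rw [range_coe_eq hn hr hjr]
    exact ⟨(g • j y).2, irreducible_smul hn hr (hirr y) g⟩
  have htr : ∀ y z, p y = p z → ∃ g : (Fin n → (Cspace m →L[ℂ] Cspace m)) → _,
      ContDiff ℝ ∞ g ∧ g (j y).1 = (j z).1 ∧
      ∀ y', ∃ z', g (j y').1 = (j z').1 ∧ p z' = p y' := fun y z hyz => by
    obtain ⟨g, hg⟩ := (hpi y z).1 hyz
    refine ⟨fun x => g • x, contDiff_smul_tuple g, hg, fun y' => ?_⟩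
    obtain ⟨z', hz'⟩ := hG g y'
    exact ⟨z', hz'.symm, ((hpi y' z').2 ⟨g, hz'.symm⟩).symm⟩
  -- The expected dimensions may be negative when there are no polygons; then no chart is needed and
  -- zero serves for both.
  rcases isEmpty_or_nonempty X with hX | ⟨⟨x₀⟩⟩
  · exact ⟨0, 0, fun ⟨x⟩ => isEmptyElim x, isSmoothQuotient_of_quotientChart
      (C := EuclideanSpace ℝ (Fin 0)) (Z := Fin n → (Cspace m →L[ℂ] Cspace m)) hi hp.continuous
      hp.isOpenMap hp.surjective (ContinuousLinearEquiv.ofFinrankEq (by simp))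
      (ContinuousLinearEquiv.ofFinrankEq (by simp)) (fun x => isEmptyElim x) htr⟩
  have hc : Module.finrank ℝ (tracelessHermitian (Cspace m)) + 1 = (m + 1) ^ 2 :=
    finrank_tracelessHermitian.trans (congrArg (· ^ 2) finrank_Cspace)
  have hcW := two_mul_finrank_le hn hr (hirr x₀)
  have h2 : 2 * m * n ≤ Module.finrank ℝ (Fin n → (Cspace m →L[ℂ] Cspace m)) := by
    rw [finrank_tuples]
    nlinarith [Nat.zero_le (n * (m ^ 2 + m + 1))]
  generalize hC : Module.finrank ℝ (tracelessHermitian (Cspace m)) = c at hc hcW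
  generalize hE : Module.finrank ℝ (Fin n → (Cspace m →L[ℂ] Cspace m)) = d at h2
  -- `b = 2mn - 2c` is the dimension of the quotient, `b + c` that of the space of polygons, and `k`
  -- its codimension among all tuples.
  obtain ⟨b, hb⟩ := Nat.exists_eq_add_of_le hcW
  obtain ⟨k, hk⟩ := Nat.exists_eq_add_of_le (show b + c ≤ d by omega)
  have hdim : ∀ l, Module.finrank ℝ (EuclideanSpace ℝ (Fin l)) = l := fun _ =>
    finrank_euclideanSpace_fin
  have hκ : Module.finrank ℝ (EuclideanSpace ℝ (Fin (b + c))) =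
      Module.finrank ℝ (EuclideanSpace ℝ (Fin b) × tracelessHermitian (Cspace m)) := by
    rw [finrank_euclidean_prod, hdim, hC]
  have hℓ : Module.finrank ℝ ((EuclideanSpace ℝ (Fin b) × tracelessHermitian (Cspace m)) ×
      EuclideanSpace ℝ (Fin k)) = Module.finrank ℝ (Fin n → (Cspace m →L[ℂ] Cspace m)) := by
    rw [finrank_prod_euclidean, finrank_euclidean_prod, hC, hE, hk]
  have hch := exists_quotientChart_polygon (B := EuclideanSpace ℝ (Fin b))
    (T := EuclideanSpace ℝ (Fin (b + c))) (Z := EuclideanSpace ℝ (Fin k)) hn hr hjr hpi hG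
    (by rw [hdim, hC, hb]; ring) (by rw [hdim, hdim, hC]) (by rw [hdim, hdim, hE, hk])
  refine ⟨b + c, b, fun _ => ?_, isSmoothQuotient_of_quotientChart hi hp.continuous
    hp.isOpenMap hp.surjective (ContinuousLinearEquiv.ofFinrankEq hκ)
    (ContinuousLinearEquiv.ofFinrankEq hℓ) hch htr⟩
  have h1 : (c : ℤ) + 1 = (m + 1) ^ 2 := by exact_mod_cast hc
  have h3 : (2 : ℤ) * m * n = 2 * c + b := by exact_mod_cast hb
  push_cast
  constructor
  · linarith
  · linear_combination -2 * h1 - h3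

theorem decomposableSet_eq_empty (h : ¬ OnWall m r) : decomposableSet m r = ∅ :=
  eq_empty_of_forall_notMem fun _ ⟨I, k, _, hI, hw, _⟩ => h ⟨I, k, hI, hw⟩

end Main

end HermPolygon

end

theorem theorem4p11 (m n : ℕ) (hn : 0 < n) (r : Fin n → ℝ) (hr : ∀ i, 0 < r i) :
    -- `M̃_r - Σ̃_r` is a smooth manifold, and so is its quotient `M_r - Σ_r`.
    (∃ a b : ℕ,
      (Nonempty ((decomposableSet m r)ᶜ : Set (ClosedPolygon m r)) →
        (a : ℤ) = 2 * m * n - ((m + 1) ^ 2 - 1) ∧ (b : ℤ) = 2 * m * (n - m - 2)) ∧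
      IsSmoothQuotient a b
        (fun e : ((decomposableSet m r)ᶜ : Set (ClosedPolygon m r)) => e.1.1)
        (projRegular m r)) ∧
    -- `SU(m+1)`, modulo its center, acts freely on `M̃_r - Σ̃_r`.
    (∀ e ∈ (decomposableSet m r)ᶜ, MulAction.stabilizer (SU m) e = Subgroup.center (SU m)) ∧
    -- The points of `M_r` are the `SU(m+1)`-orbits.
    (∀ e e' : ClosedPolygon m r, proj m r e = proj m r e' ↔ ∃ g : SU m, g • e = e') ∧
    -- If `r` lies on no wall, then all of `M_r` is a smooth manifold.
    (¬ OnWall m r → ∃ a b : ℕ,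
      (Nonempty (ModuliSpace m r) →
        (a : ℤ) = 2 * m * n - ((m + 1) ^ 2 - 1) ∧ (b : ℤ) = 2 * m * (n - m - 2)) ∧
      IsSmoothQuotient a b (fun e : ClosedPolygon m r => e.1) (proj m r)) := by
  refine ⟨exists_isSmoothQuotient hn hr Topology.IsEmbedding.subtypeVal Subtype.range_coe
    isOpenQuotientMap_projRegular fun y z => Subtype.ext_iff,
    fun e he => stabilizer_eq_center ((isIrreducible_iff_not_isDecomposable hn hr).2 he),
    fun e e' => proj_eq_proj_iff_specialUnitary, fun hw => ?_⟩
  -- Off the walls there are no decomposable polygons, so `j` may be the identity.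
  obtain ⟨a, b, h, h'⟩ := exists_isSmoothQuotient hn hr (j := id) Topology.IsEmbedding.id
    (by rw [Set.range_id, decomposableSet_eq_empty hw, Set.compl_empty])
    (isOpenQuotientMap_proj (m := m) (r := r)) fun y z => Iff.rfl
  exact ⟨a, b, fun ⟨q⟩ => h (nonempty_quotient_iff _ |>.1 ⟨q⟩), h'⟩
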